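/- Let $\rho$ be a probability measure on $\mathbb{R}^d\times\{1,-1\}$ whose inputs lie in a bounded set $\mathcal X\subset\mathbb{R}^d$, and let $p=\Pr(y=1)\in(0,1)$. Let $\lambda>0$, $\Omega(w)=\lambda\|w\|_2^2/2$, $$f(w)=p(1-p)\,\mathbb{E}\big[(1-w^\top(x-x'))^2\,\big|\,y=1,\,y'=-1\big],\qquad \phi=f+\Omega,$$ where $(x,y)$ and $(x',y')$ are independent draws from $\rho$. Let $S^*$ be the set of minimizers of $\phi$, and let $w^*$ be the projection of $w$ onto $S^*$. Let $z_t=(x_t,y_t)$, $t\ge 0$, be independent draws from $\rho$. For $t\ge 1$ let $p_t$ be the fraction of positive labels among $z_0,\dots,z_{t-1}$, and let $u_t$ and $v_t$ be the means of the inputs with label $1$ and label $-1$ among $z_0,\dots,z_{t-1}$ (a mean over no input is $0$). For $z=(x,y)$ put $$\hat F_t(w;z)=(1-p_t)(w^\top(x-u_t))^2\mathbb{I}_{[y=1]}+p_t(w^\top(x-v_t))^2\mathbb{I}_{[y=-1]}+2p_t(1-p_t)w^\top(v_t-u_t)+p_t(1-p_t)(w^\top(v_t-u_t))^2+p_t(1-p_t),$$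 and let $\hat F_t'$ be its gradient in $w$. For step sizes $\eta_t>0$ the algorithm SPAUC sets $w_1=0$ and, for $t\ge1$, $$w_{t+1}=\arg\min_{w}\ \eta_t\langle w-w_t,\hat F_t'(w_t;z_t)\rangle+\eta_t\Omega(w)+\tfrac12\|w-w_t\|_2^2 .$$ Consider the following conditions, in which $\Omega'(w)$ is a subgradient (here the gradient) of $\Omega$ at $w$: * (self-bounding) $\|\Omega'(w)\|_2^2\le A_1\Omega(w)+A_2$ for all $w$; * (quadratic growth) $\phi(w)-\phi(w^*)\ge\sigma_\phi\|w-w^*\|_2^2$ for all $w$; * (convexity modulus) $\Omega(w)-\Omega(v)-\langle w-v,\Omega'(v)\rangle\ge\frac{\sigma_\Omega}{2}\|w-v\|_2^2$ for all $w,v$. Then they hold with $(A_1,A_2)=(2\lambda,0)$, with $\sigma_\phi=\lambda/2$, and with $\sigma_\Omega=\lambda$, respectively. Moreover, there is an absolute integer $m\ge0$ such that the following is true. Let $A_1,A_2\ge0$, $\sigma_\phi>0$ and $0\le\sigma_\Omega\le\sigma_\phi$ be any constants satisfying these three conditions. Put $\sigma_f=\sigma_\phi-\sigma_\Omega$, $\kappa=\max\{1,\sup_{x\in\mathcal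 X}\|x\|_2\}$ and $C_1=\max\{A_1,16\kappa^2\}$. Then there is a constant $C>0$, depending only on $d,\mathcal X,\rho,\lambda,A_1,A_2,\sigma_\phi,\sigma_\Omega$, such that for all $\delta\in(0,1)$, all integers $T>2$ and all real $t_1\ge 32C_1\sigma_\phi^{-1}\log\frac{2T}{\delta}$, the sequence $(w_t)$ produced by SPAUC with $\eta_t=\frac{2}{\sigma_\phi t+2\sigma_f+\sigma_\phi t_1}$ satisfies, with probability at least $1-\delta$, simultaneously for all $t=1,\dots,T$, $$\|w_t-w_t^*\|_2^2\le\frac{C\,t_1\log^m(T/\delta)}{t}\qquad\text{and}\qquad \phi(\bar w_t^{(2)})-\inf_w\phi(w)\le\frac{C\,t_1^2\log^m(T/\delta)}{t},$$ where $$\bar w_t^{(2)}=\Big(\sum_{k=1}^t(k+t_1+1)\Big)^{-1}\sum_{k=1}^t(k+t_1+1)\,w_k .$$ In particular, if $t_1$ is of the order of $\log(2T/\delta)$, both quantities are $\widetilde O(1/t)$. -/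

import Mathlib

open MeasureTheory ProbabilityTheory

noncomputable section

namespace AUC

/-- `ℝ^d` with the Euclidean norm. -/
abbrev Vec (d : ℕ) : Type := EuclideanSpace ℝ (Fin d)

/-- An example `z = (x, y)`: an input `x ∈ ℝ^d` and a label `y` (which will be `1` or `-1`). -/
abbrev Sample (d : ℕ) : Type := Vec d × ℤ

variable {d : ℕ}

/-! ### The objective -/

/-- `p = Pr(y = 1)`. -/
def posProb (ρ : Measure (Sample d)) : ℝ := ρ.real {z | z.2 = 1}

/-- `f(w) = p (1 - p) E[(1 - wᵀ(x - x'))² | y = 1, y' = -1]`, where `(x, y)` and `(x', y')` are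
drawn independently from `ρ`. -/
def risk (ρ : Measure (Sample d)) (w : Vec d) : ℝ :=
  posProb ρ * (1 - posProb ρ) *
    ∫ q, (1 - inner ℝ w (q.1.1 - q.2.1)) ^ 2
      ∂(cond (ρ.prod ρ) {q : Sample d × Sample d | q.1.2 = 1 ∧ q.2.2 = -1})

/-- The regularizer `Ω(w) = lam ‖w‖² / 2`. -/
def l2Reg (lam : ℝ) (w : Vec d) : ℝ := lam * ‖w‖ ^ 2 / 2

/-- `φ = f + Ω`. -/
def objective (ρ : Measure (Sample d)) (reg : Vec d → ℝ) (w : Vec d) : ℝ := risk ρ w + reg w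

/-- The set `S*` of global minimizers of `φ`. -/
def minimizers (φ : Vec d → ℝ) : Set (Vec d) := {w | ∀ v, φ w ≤ φ v}

/-- `ws` is a point of `S` at minimal distance from `w` (a projection of `w` onto `S`). -/
def IsProjection (S : Set (Vec d)) (w ws : Vec d) : Prop :=
  ws ∈ S ∧ ∀ v ∈ S, ‖w - ws‖ ≤ ‖w - v‖

/-! ### Assumptions and their constants -/

/-- `g` is a subgradient of `reg` at `w`. -/
def IsSubgradient (reg : Vec d → ℝ) (w g : Vec d) : Prop :=
  ∀ v, reg w + inner ℝ g (v - w) ≤ reg v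

/-- The self-bounding property `‖Ω'(w)‖² ≤ A₁ Ω(w) + A₂`. -/
def SelfBounding (reg : Vec d → ℝ) (A₁ A₂ : ℝ) : Prop :=
  ∀ w g, IsSubgradient reg w g → ‖g‖ ^ 2 ≤ A₁ * reg w + A₂

/-- Quadratic functional growth: `φ(w) - φ(w*) ≥ σ ‖w - w*‖²` for all `w`,
where `w*` is the projection of `w` onto the set of minimizers of `φ`. -/
def QuadraticGrowth (φ : Vec d → ℝ) (σ : ℝ) : Prop :=
  ∀ w, ∃ ws, IsProjection (minimizers φ) w ws ∧ σ * ‖w - ws‖ ^ 2 ≤ φ w - φ ws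

/-- `Ω(w) - Ω(v) - ⟨w - v, Ω'(v)⟩ ≥ (σ / 2) ‖w - v‖²` for all `w, v`. -/
def ConvexityModulus (reg : Vec d → ℝ) (σ : ℝ) : Prop :=
  ∀ w v g, IsSubgradient reg v g → σ / 2 * ‖w - v‖ ^ 2 ≤ reg w - reg v - inner ℝ (w - v) g

/-- `κ = max {1, sup_{x ∈ X} ‖x‖}`. -/
def kappa (X : Set (Vec d)) : ℝ := max 1 (⨆ x : X, ‖(x : Vec d)‖)

/-- `C₁ = max {A₁, 16 κ²}`. -/
def constC₁ (X : Set (Vec d)) (A₁ : ℝ) : ℝ := max A₁ (16 * kappa X ^ 2)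

/-! ### The algorithm -/

/-- The examples among `z_0, …, z_{t-1}` with label `y`. -/
def labelled (z : ℕ → Sample d) (t : ℕ) (y : ℤ) : Finset ℕ :=
  (Finset.range t).filter fun i => (z i).2 = y

/-- `p_t`, the fraction of positive examples among `z_0, …, z_{t-1}`. -/
def empProb (z : ℕ → Sample d) (t : ℕ) : ℝ := ((labelled z t 1).card : ℝ) / t

/-- The mean of the inputs with label `y` among `z_0, …, z_{t-1}` (`0` if there are none):
`u_t` for `y = 1` and `v_t` for `y = -1`. -/
def empMean (z : ℕ → Sample d) (t : ℕ) (y : ℤ) : Vec d :=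
  ((labelled z t y).card : ℝ)⁻¹ • ∑ i ∈ labelled z t y, (z i).1

/-- The loss `F̂_t(w; z)`, as a function of `p = p_t`, `u = u_t`, `v = v_t`. -/
def loss (p : ℝ) (u v : Vec d) (w : Vec d) (z : Sample d) : ℝ :=
  (1 - p) * inner ℝ w (z.1 - u) ^ 2 * (if z.2 = 1 then 1 else 0)
    + p * inner ℝ w (z.1 - v) ^ 2 * (if z.2 = -1 then 1 else 0)
    + 2 * p * (1 - p) * inner ℝ w (v - u)
    + p * (1 - p) * inner ℝ w (v - u) ^ 2
    + p * (1 - p)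

/-- The gradient `F̂_t'(w; z)` of the loss with respect to `w`; see `hasGradientAt_loss`. -/
def lossGrad (p : ℝ) (u v : Vec d) (w : Vec d) (z : Sample d) : Vec d :=
  (2 * (1 - p) * inner ℝ w (z.1 - u) * (if z.2 = 1 then 1 else 0)) • (z.1 - u)
    + (2 * p * inner ℝ w (z.1 - v) * (if z.2 = -1 then 1 else 0)) • (z.1 - v)
    + (2 * p * (1 - p)) • (v - u)
    + (2 * p * (1 - p) * inner ℝ w (v - u)) • (v - u)

theorem hasGradientAt_loss (p : ℝ) (u v w : Vec d) (z : Sample d) :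
    HasGradientAt (fun w' => loss p u v w' z) (lossGrad p u v w z) w := by
  have h : ∀ a : Vec d, HasFDerivAt (fun w' : Vec d => inner ℝ w' a) (innerSL ℝ a) w := by
    intro a
    have := (innerSL ℝ a).hasFDerivAt (x := w)
    refine this.congr_of_eventuallyEq (Filter.Eventually.of_forall fun x => ?_)
    simp [real_inner_comm]
  rw [hasGradientAt_iff_hasFDerivAt]
  have h1 := (((h (z.1 - u)).pow 2).const_mul (1 - p)).mul_const
    (if z.2 = 1 then (1 : ℝ) else 0)
  have h2 := (((h (z.1 - v)).pow 2).const_mul p).mul_const (if z.2 = -1 then (1 : ℝ) else 0)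
  have h3 := (h (v - u)).const_mul (2 * p * (1 - p))
  have h4 := ((h (v - u)).pow 2).const_mul (p * (1 - p))
  refine (((((h1.add h2).add h3).add h4).add_const (p * (1 - p)))).congr_fderiv ?_
  ext x
  by_cases hp : z.2 = 1 <;> by_cases hn : z.2 = -1 <;>
    simp [lossGrad, hp, hn] <;> ring

/-- `(w_t)_{t ≥ 1}` is produced by stochastic proximal AUC maximization with step sizes `η_t`,
regularizer `reg` and examples `z_0, z_1, …`: `w_1 = 0`, and for `t ≥ 1` the point `w_{t+1}` minimizes
`η_t ⟨w - w_t, F̂_t'(w_t; z_t)⟩ + η_t Ω(w) + ‖w - w_t‖² / 2` over `w ∈ ℝ^d`. -/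
def IsSPAUC (η : ℕ → ℝ) (reg : Vec d → ℝ) (z : ℕ → Sample d) (w : ℕ → Vec d) : Prop :=
  w 1 = 0 ∧ ∀ t, 1 ≤ t → ∀ v,
    let g := lossGrad (empProb z t) (empMean z t 1) (empMean z t (-1)) (w t) (z t)
    let J := fun u : Vec d =>
      η t * inner ℝ (u - w t) g + η t * reg u + 1 / 2 * ‖u - w t‖ ^ 2
    J (w (t + 1)) ≤ J v

/-- `η_t = 2 / (σ_φ t + 2 σ_f + σ_φ t₁)` with `σ_f = σ_φ - σ_Ω`. -/
def stepSize (σφ σΩ t₁ : ℝ) (t : ℕ) : ℝ := 2 / (σφ * t + 2 * (σφ - σΩ) + σφ * t₁)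

/-- The weighted average `(∑_{k=1}^t (k + t₁ + 1))⁻¹ ∑_{k=1}^t (k + t₁ + 1) w_k`. -/
def weightedAvg (t₁ : ℝ) (w : ℕ → Vec d) (t : ℕ) : Vec d :=
  (∑ k ∈ Finset.Icc 1 t, ((k : ℝ) + t₁ + 1))⁻¹ •
    ∑ k ∈ Finset.Icc 1 t, ((k : ℝ) + t₁ + 1) • w k

end AUC

end

noncomputable section

namespace AUC

/-! ### An exponential inequality for sums adapted to an independent sequence -/

section Concentration

open Real

variable {S E F : Type*} [MeasurableSpace S] [MeasurableSpace E] [MeasurableSpace F]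

/-! Given the true class probability and class means, the loss is an unbiased saddle-point form of
`f`: its expected gradient is the gradient of `f` (`risk_add`). The objective `φ` is an exactly
quadratic function with a unique minimizer `w*`, so `φ(w) - φ(w*)` is a quadratic form `Q(w - w*)`,
and `⟨w - w*, φ'(w)⟩ = 2 Q(w - w*)` is at least `2 σ_φ ‖w - w*‖²`.

A proximal step is a plain gradient step on the regularized loss with the reduced step size `η / (1
+ η λ)`, which here equals `2 / (σ_φ s_k)` with `s_k = k + t₁ + a` for a constant `a`. The direction
splits into `φ'(w_k)`, a centred noise, and a bias caused by replacing `p, u, v` by `p_k, u_k, v_k`.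
The iterates stay in a fixed ball deterministically, so all gradients are bounded. The gradient is
Lipschitz in `(p, u, v)`, so by Hoeffding bounds the squared bias at step `k` is `O(L / k)`, with
`L` logarithmic in `T / δ`.

Multiplying the one-step inequality by `(s_k + 1)²` makes `s_k² ‖w_k - w*‖²` telescope and leaves a
surplus `-3 s_k ‖w_k - w*‖²` (`descent_step`). The surplus controls the noise: the noise increment
at step `k` is conditionally centred and bounded by a multiple of `s_k ‖w_k - w*‖`, so in the
exponential supermartingale inequality (`IsIncrement.measure_sum_ge_le`) its random compensator is a
multiple of `s_k² ‖w_k - w*‖²`. If the sum up to `t` is weighted by a small multiple of `1 / s_t`,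
the compensator is at most the equally weighted surplus (`noiseWeight_sq_le`). No a priori decay of
`‖w_k - w*‖` is needed, and what remains of the noise is `O(L s_t)`. Dividing by `s_{t+1}²` gives
the rate for the iterates.

For the averages, the rate for each `w_k` passes through Cauchy–Schwarz at the cost of one more
logarithm, and `φ - φ(w*)` is at most a multiple of the squared distance to `w*`. -/

/-- Hoeffding's lemma for a centred variable that is bounded by `c` in absolute value. -/
theorem lintegral_exp_le_of_abs_le (ρ : Measure E) [IsProbabilityMeasure ρ] {X : E → ℝ} {c : ℝ}
    (hX : Measurable X) (hc : ∀ᵐ x ∂ρ, |X x| ≤ c) (h0 : ∫ x, X x ∂ρ = 0) :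
    ∫⁻ x, ENNReal.ofReal (exp (X x)) ∂ρ ≤ ENNReal.ofReal (exp (c ^ 2 / 2)) := by
  have hb : ∀ᵐ x ∂ρ, X x ∈ Set.Icc (-c) c := by
    filter_upwards [hc] with x hx using abs_le.1 hx
  have hs := hasSubgaussianMGF_of_mem_Icc_of_integral_eq_zero hX.aemeasurable hb h0
  have hi := hs.integrable_exp_mul 1
  have hm := hs.mgf_le 1
  simp only [one_mul, mgf] at hi hm
  rw [← ofReal_integral_eq_lintegral_ofReal hi (ae_of_all _ fun x => (exp_pos _).le)]
  refine ENNReal.ofReal_le_ofReal (hm.trans (le_of_eq ?_))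
  congr 1
  push_cast
  rw [Real.norm_eq_abs, div_pow, sq_abs]
  ring

/-- One step of the supermartingale argument: integrating out a variable `Z` that is independent
of the past `Y`. -/
theorem lintegral_exp_add_le (P : Measure S) [IsProbabilityMeasure P] {Y : S → F} {Z : S → E}
    (hY : Measurable Y) (hZ : Measurable Z) (hind : IndepFun Y Z P)
    {G : F → ℝ} {h : F → E → ℝ} {c : F → ℝ} (hG : Measurable G)
    (hh : Measurable (Function.uncurry h)) (hc : Measurable c)
    (hb : ∀ᵐ y ∂(P.map Y), (∀ᵐ x ∂(P.map Z), |h y x| ≤ c y) ∧ ∫ x, h y x ∂(P.map Z) = 0) :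
    ∫⁻ s, ENNReal.ofReal (exp (G (Y s) + (h (Y s) (Z s) - c (Y s) ^ 2 / 2))) ∂P
      ≤ ∫⁻ s, ENNReal.ofReal (exp (G (Y s))) ∂P := by
  have hPY : IsProbabilityMeasure (P.map Y) := Measure.isProbabilityMeasure_map hY.aemeasurable
  have hPZ : IsProbabilityMeasure (P.map Z) := Measure.isProbabilityMeasure_map hZ.aemeasurable
  have hmap := (indepFun_iff_map_prod_eq_prod_map_map hY.aemeasurable hZ.aemeasurable).1 hind
  have hΨ : Measurable fun q : F × E =>
      ENNReal.ofReal (exp (G q.1 + (h q.1 q.2 - c q.1 ^ 2 / 2))) := by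
    have : Measurable fun q : F × E => h q.1 q.2 := hh
    fun_prop
  have h1 : ∫⁻ s, ENNReal.ofReal (exp (G (Y s) + (h (Y s) (Z s) - c (Y s) ^ 2 / 2))) ∂P
      = ∫⁻ y, ∫⁻ x, ENNReal.ofReal (exp (G y + (h y x - c y ^ 2 / 2))) ∂(P.map Z) ∂(P.map Y) := by
    rw [← lintegral_prod _ hΨ.aemeasurable, ← hmap, lintegral_map hΨ (hY.prodMk hZ)]
  have h2 : ∫⁻ s, ENNReal.ofReal (exp (G (Y s))) ∂P
      = ∫⁻ y, ENNReal.ofReal (exp (G y)) ∂(P.map Y) := by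
    rw [lintegral_map (by fun_prop) hY]
  rw [h1, h2]
  refine lintegral_mono_ae ?_
  filter_upwards [hb] with y hy
  have hmy : Measurable (h y) := hh.comp measurable_prodMk_left
  have hsplit : ∀ x, ENNReal.ofReal (exp (G y + (h y x - c y ^ 2 / 2)))
      = ENNReal.ofReal (exp (G y - c y ^ 2 / 2)) * ENNReal.ofReal (exp (h y x)) := by
    intro x
    rw [← ENNReal.ofReal_mul (exp_pos _).le, ← exp_add]
    ring_nf
  simp_rw [hsplit]
  rw [lintegral_const_mul _ (by fun_prop)]
  calc _ ≤ ENNReal.ofReal (exp (G y - c y ^ 2 / 2)) * ENNReal.ofReal (exp (c y ^ 2 / 2)) := by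
        gcongr
        exact lintegral_exp_le_of_abs_le _ hmy hy.1 hy.2
    _ = _ := by
        rw [← ENNReal.ofReal_mul (exp_pos _).le, ← exp_add]
        ring_nf

/-- The sequence `y` with everything from index `n` on replaced by `e`. -/
def truncateSeq (e : E) (n : ℕ) (y : ℕ → E) : ℕ → E := fun i => if i < n then y i else e

theorem truncateSeq_of_lt {E : Type*} (e : E) {n i : ℕ} (y : ℕ → E) (h : i < n) :
    truncateSeq e n y i = y i := if_pos h

theorem measurable_truncateSeq (e : E) (n : ℕ) : Measurable (truncateSeq (E := E) e n) := by
  refine measurable_pi_lambda _ fun i => ?_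
  by_cases h : i < n
  · simpa [truncateSeq, h] using measurable_pi_apply i
  · simp [truncateSeq, h]

/-- The truncated sequence is a function of the finite block of observations before `n`, which is
independent of the `n`-th one. It stands in for the past, so that functions of whole sequences can
be used without filtrations or conditional expectations. -/
theorem indepFun_truncateSeq {P : Measure S} {z : ℕ → S → E} (hz : ∀ t, Measurable (z t))
    (hind : iIndepFun z P) (e : E) (n : ℕ) :
    IndepFun (fun s => truncateSeq e n fun t => z t s) (z n) P := by
  have h := hind.indepFun_finset (Finset.range n) {n} (by simp) hz
  have hφ : Measurable fun (y : Finset.range n → E) (i : ℕ) =>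
      if hi : i ∈ Finset.range n then y ⟨i, hi⟩ else e := by
    refine measurable_pi_lambda _ fun i => ?_
    by_cases hi : i ∈ Finset.range n
    · simpa only [hi, dif_pos] using measurable_pi_apply _
    · simp only [hi, dif_neg, not_false_eq_true, measurable_const]
  have hψ : Measurable fun y : ({n} : Finset ℕ) → E => y ⟨n, by simp⟩ := measurable_pi_apply _
  have h' := h.comp hφ hψ
  refine (IndepFun.congr h' ?_ ?_)
  · refine ae_of_all _ fun s => ?_
    funext i
    by_cases hi : i < n <;> simp [truncateSeq, hi]
  · exact ae_of_all _ fun s => rfl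

/-- A function of sequences that only depends on the terms before `n`. -/
def DependsOnPast {β : Type*} (n : ℕ) (f : (ℕ → E) → β) : Prop :=
  ∀ y y' : ℕ → E, (∀ i < n, y i = y' i) → f y = f y'

/-- `h k y x` are centred increments, with `x` the current and `y` the past observations, that are
bounded by `c k y` as long as all observations lie in `K`. -/
structure IsIncrement (ρ : Measure E) (K : Set E) (h : ℕ → (ℕ → E) → E → ℝ)
    (c : ℕ → (ℕ → E) → ℝ) : Prop where
  measurable : ∀ k, Measurable (Function.uncurry (h k))
  measurable_bound : ∀ k, Measurable (c k)
  past : ∀ k, DependsOnPast k (h k)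
  past_bound : ∀ k, DependsOnPast k (c k)
  abs_le : ∀ k y, (∀ i, y i ∈ K) → ∀ x ∈ K, |h k y x| ≤ c k y
  integral_eq : ∀ k y, (∀ i, y i ∈ K) → ∫ x, h k y x ∂ρ = 0

variable {ρ : Measure E} {K : Set E} {P : Measure S} [IsProbabilityMeasure P]
  {h : ℕ → (ℕ → E) → E → ℝ} {c : ℕ → (ℕ → E) → ℝ} {z : ℕ → S → E}

/-- The exponential is a supermartingale: the last factor is integrated out over `z n`, with the
past frozen, by Hoeffding's lemma. Truncation changes no term with index up to `n`, as these only
see the past and the current observation. -/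
theorem IsIncrement.lintegral_exp_sum_le_one (H : IsIncrement ρ K h c)
    (hKm : MeasurableSet K) (hK : K.Nonempty) (hKρ : ∀ᵐ x ∂ρ, x ∈ K)
    (hz : ∀ t, Measurable (z t)) (hρ : ∀ t, P.map (z t) = ρ) (hind : iIndepFun z P) (n : ℕ) :
    ∫⁻ s, ENNReal.ofReal (exp (∑ k ∈ Finset.range n,
      (h k (fun t => z t s) (z k s) - c k (fun t => z t s) ^ 2 / 2))) ∂P ≤ 1 := by
  obtain ⟨e, he⟩ := hK
  induction n with
  | zero => simp
  | succ n ih =>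
    refine le_trans (le_of_eq_of_le ?_ (lintegral_exp_add_le P
      (Y := fun s => truncateSeq e n fun t => z t s) (Z := z n)
      (G := fun y => ∑ k ∈ Finset.range n, (h k y (y k) - c k y ^ 2 / 2))
      (h := h n) (c := c n) ?_ (hz n) (indepFun_truncateSeq hz hind e n) ?_ (H.measurable n)
      (H.measurable_bound n) ?_)) (le_of_eq_of_le ?_ ih)
    · refine lintegral_congr fun s => ?_
      rw [Finset.sum_range_succ]
      have hp : ∀ k ≤ n, ∀ i < k, (fun t => z t s) i
          = truncateSeq e n (fun t => z t s) i := fun k hk i hi =>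
        (truncateSeq_of_lt e (fun t => z t s) (hi.trans_le hk)).symm
      congr 2
      refine congrArg₂ _ ?_ (congrArg₂ _ ?_ (congrArg₂ _ (congrArg₂ _ ?_ rfl) rfl))
      · refine Finset.sum_congr rfl fun k hk => ?_
        have hk' := Finset.mem_range.1 hk
        rw [H.past k _ _ (hp k hk'.le), H.past_bound k _ _ (hp k hk'.le),
          truncateSeq_of_lt e _ hk']
      · rw [H.past n _ _ (hp n le_rfl)]
      · rw [H.past_bound n _ _ (hp n le_rfl)]
    · exact (measurable_truncateSeq e n).comp (measurable_pi_lambda _ hz)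
    · refine Finset.measurable_sum _ fun k _ => ?_
      have h1 : Measurable fun y : ℕ → E => h k y (y k) :=
        (H.measurable k).comp (measurable_id.prodMk (measurable_pi_apply k))
      have h2 := H.measurable_bound k
      exact h1.sub ((h2.pow_const 2).div_const 2)
    · rw [hρ n]
      have hY : Measurable fun s => truncateSeq e n fun t => z t s :=
        (measurable_truncateSeq e n).comp (measurable_pi_lambda _ hz)
      -- The filler `e` lies in `K`, so the truncated sequence satisfies at every index the
      -- condition under which increments are bounded and centred.
      have hall : ∀ᵐ y ∂(P.map fun s => truncateSeq e n fun t => z t s), ∀ i, y i ∈ K := by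
        rw [ae_all_iff]
        intro i
        rw [ae_map_iff hY.aemeasurable ((measurable_pi_apply i) hKm)]
        have hi : ∀ᵐ s ∂P, z i s ∈ K := by
          have := hρ i
          rw [← this] at hKρ
          exact (ae_map_iff (hz i).aemeasurable hKm).1 hKρ
        filter_upwards [hi] with s hs
        by_cases hin : i < n
        · simpa [truncateSeq, hin] using hs
        · simpa [truncateSeq, hin] using he
      filter_upwards [hall] with y hy
      refine ⟨?_, H.integral_eq n y hy⟩
      filter_upwards [hKρ] with x hx using H.abs_le n y hy x hx
    · refine lintegral_congr fun s => ?_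
      have hp : ∀ k ≤ n, ∀ i < k, truncateSeq e n (fun t => z t s) i
          = (fun t => z t s) i := fun k hk i hi =>
        truncateSeq_of_lt e _ (hi.trans_le hk)
      congr 2
      refine Finset.sum_congr rfl fun k hk => ?_
      have hk' := Finset.mem_range.1 hk
      rw [H.past k _ _ (hp k hk'.le), H.past_bound k _ _ (hp k hk'.le),
          truncateSeq_of_lt e _ hk']

/-- Markov's inequality for the exponential. The compensator remains random and inside the sum, so
that it can later be compared with random terms of the descent inequality. -/
theorem IsIncrement.measure_sum_ge_le (H : IsIncrement ρ K h c)
    (hKm : MeasurableSet K) (hK : K.Nonempty) (hKρ : ∀ᵐ x ∂ρ, x ∈ K)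
    (hz : ∀ t, Measurable (z t)) (hρ : ∀ t, P.map (z t) = ρ) (hind : iIndepFun z P) (n : ℕ)
    (L : ℝ) :
    P {s | L ≤ ∑ k ∈ Finset.range n,
      (h k (fun t => z t s) (z k s) - c k (fun t => z t s) ^ 2 / 2)}
      ≤ ENNReal.ofReal (exp (-L)) := by
  have h1 := H.lintegral_exp_sum_le_one hKm hK hKρ hz hρ hind n
  have hseq : Measurable fun s t => z t s := measurable_pi_lambda _ hz
  have hm : Measurable fun s => ∑ k ∈ Finset.range n,
      (h k (fun t => z t s) (z k s) - c k (fun t => z t s) ^ 2 / 2) := by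
    refine Finset.measurable_sum _ fun k _ => ?_
    have h1 : Measurable fun s => h k (fun t => z t s) (z k s) :=
      (H.measurable k).comp (hseq.prodMk (hz k))
    have h2 : Measurable fun s => c k (fun t => z t s) := (H.measurable_bound k).comp hseq
    exact h1.sub ((h2.pow_const 2).div_const 2)
  have h2 := meas_ge_le_lintegral_div (μ := P) (f := fun s => ENNReal.ofReal (exp
    (∑ k ∈ Finset.range n, (h k (fun t => z t s) (z k s) - c k (fun t => z t s) ^ 2 / 2))))
    hm.exp.ennreal_ofReal.aemeasurable (ε := ENNReal.ofReal (exp L)) (by simp [exp_pos]) (by simp)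
  calc _ ≤ _ := measure_mono fun s hs =>
        ENNReal.ofReal_le_ofReal (exp_le_exp.2 hs)
    _ ≤ _ := h2
    _ ≤ 1 / ENNReal.ofReal (exp L) := by gcongr
    _ = _ := by
      rw [one_div, exp_neg, ENNReal.ofReal_inv_of_pos (exp_pos _)]

end Concentration

/-! ### Moments of the classes and the second-order expansion of the objective -/

section Objective

variable {d : ℕ}

/-- `f` is integrable with mean `a`. -/
def HasMean {E : Type*} [MeasurableSpace E] (ρ : Measure E) (f : E → ℝ) (a : ℝ) : Prop :=
  Integrable f ρ ∧ ∫ x, f x ∂ρ = a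

namespace HasMean

variable {E : Type*} [MeasurableSpace E] {ρ : Measure E} {f g : E → ℝ} {a b : ℝ}

theorem add (hf : HasMean ρ f a) (hg : HasMean ρ g b) :
    HasMean ρ (fun x => f x + g x) (a + b) :=
  ⟨hf.1.add hg.1, by rw [integral_add hf.1 hg.1, hf.2, hg.2]⟩

theorem const_mul (r : ℝ) (hf : HasMean ρ f a) : HasMean ρ (fun x => r * f x) (r * a) :=
  ⟨hf.1.const_mul r, by rw [integral_const_mul, hf.2]⟩

theorem const [IsProbabilityMeasure ρ] (r : ℝ) : HasMean ρ (fun _ => r) r :=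
  ⟨integrable_const r, by simp⟩

theorem prod {E' : Type*} [MeasurableSpace E'] {ρ' : Measure E'} [SFinite ρ] [SFinite ρ']
    {g : E' → ℝ} (hf : HasMean ρ f a) (hg : HasMean ρ' g b) :
    HasMean (ρ.prod ρ') (fun q => f q.1 * g q.2) (a * b) :=
  ⟨hf.1.mul_prod hg.1, by rw [integral_prod_mul, hf.2, hg.2]⟩

theorem congr (hf : HasMean ρ f a) (hfg : ∀ x, g x = f x) (hab : a = b) : HasMean ρ g b := by
  obtain rfl : g = f := funext hfg
  exact hab ▸ hf

end HasMean

/-- The indicator function of the label `y`. -/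
def labelInd (y : ℤ) (z : Sample d) : ℝ := if z.2 = y then 1 else 0

theorem measurableSet_label (y : ℤ) : MeasurableSet {z : Sample d | z.2 = y} :=
  measurable_snd (measurableSet_singleton y)

@[fun_prop]
theorem measurable_labelInd (y : ℤ) : Measurable (labelInd (d := d) y) :=
  Measurable.ite (measurableSet_label y) measurable_const measurable_const

theorem labelInd_nonneg (y : ℤ) (z : Sample d) : 0 ≤ labelInd y z := by
  unfold labelInd; split_ifs <;> norm_num

theorem labelInd_le_one (y : ℤ) (z : Sample d) : labelInd y z ≤ 1 := by
  unfold labelInd; split_ifs <;> norm_num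

theorem abs_labelInd_le (y : ℤ) (z : Sample d) : |labelInd y z| ≤ 1 := by
  rw [abs_of_nonneg (labelInd_nonneg y z)]; exact labelInd_le_one y z

/-- The examples with an input of norm at most `κ` and a label `1` or `-1`. -/
def goodSet (d : ℕ) (κ : ℝ) : Set (Sample d) := {z | ‖z.1‖ ≤ κ ∧ (z.2 = 1 ∨ z.2 = -1)}

theorem measurableSet_goodSet (κ : ℝ) : MeasurableSet (goodSet d κ) :=
  (measurableSet_le measurable_fst.norm measurable_const).inter
    ((measurableSet_label 1).union (measurableSet_label (-1)))

/-- The probability of the label `y`. -/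
def classProb (ρ : Measure (Sample d)) (y : ℤ) : ℝ := ∫ z, labelInd y z ∂ρ

/-- The integral of the inputs with label `y`. -/
def classIntegral (ρ : Measure (Sample d)) (y : ℤ) : Vec d := ∫ z, labelInd y z • z.1 ∂ρ

/-- The conditional mean of the inputs with label `y`. -/
def classMean (ρ : Measure (Sample d)) (y : ℤ) : Vec d := (classProb ρ y)⁻¹ • classIntegral ρ y

/-- The second moments of the inputs with label `y`. -/
def classMoment (ρ : Measure (Sample d)) (y : ℤ) (w h : Vec d) : ℝ :=
  ∫ z, labelInd y z * (inner ℝ w z.1 * inner ℝ h z.1) ∂ρ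

variable {ρ : Measure (Sample d)} {κ : ℝ}

theorem classProb_eq_real (y : ℤ) : classProb ρ y = ρ.real {z | z.2 = y} := by
  have h : (labelInd y : Sample d → ℝ) = Set.indicator {z : Sample d | z.2 = y} 1 := by
    funext z
    by_cases hz : z.2 = y <;> simp [labelInd, Set.indicator, hz]
  rw [classProb, h, integral_indicator_one (measurableSet_label y)]

theorem classProb_one : classProb ρ 1 = posProb ρ := classProb_eq_real 1

theorem classIntegral_eq (y : ℤ) (hy : classProb ρ y ≠ 0) :
    classIntegral ρ y = classProb ρ y • classMean ρ y := by
  rw [classMean, smul_smul, mul_inv_cancel₀ hy, one_smul]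

variable [IsProbabilityMeasure ρ]

theorem integrable_of_bound {β : Type*} [NormedAddCommGroup β] {f : Sample d → β} {C : ℝ}
    (hf : AEStronglyMeasurable f ρ) (hρ : ∀ᵐ z ∂ρ, z ∈ goodSet d κ)
    (h : ∀ z ∈ goodSet d κ, ‖f z‖ ≤ C) : Integrable f ρ :=
  Integrable.of_bound hf C (hρ.mono h)

theorem hasMean_labelInd (y : ℤ) : HasMean ρ (labelInd y) (classProb ρ y) := by
  refine ⟨Integrable.of_bound (by fun_prop) 1 (ae_of_all _ fun z => ?_), rfl⟩
  simpa using abs_labelInd_le y z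

theorem integrable_labelInd_smul (hρ : ∀ᵐ z ∂ρ, z ∈ goodSet d κ) (y : ℤ) :
    Integrable (fun z : Sample d => labelInd y z • z.1) ρ := by
  refine integrable_of_bound (C := κ) (by fun_prop) hρ fun z hz => ?_
  rw [norm_smul]
  exact (mul_le_of_le_one_left (norm_nonneg _) (abs_labelInd_le y z)).trans hz.1

theorem classProb_neg_one (hρ : ∀ᵐ z ∂ρ, z ∈ goodSet d κ) :
    classProb ρ (-1) = 1 - posProb ρ := by
  have h : ∫ z, (labelInd 1 z + labelInd (-1) z) ∂ρ = 1 := by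
    rw [integral_congr_ae (g := fun _ => (1 : ℝ))]
    · simp
    · filter_upwards [hρ] with z hz
      rcases hz.2 with h | h <;> simp [labelInd, h]
  rw [((hasMean_labelInd 1).add (hasMean_labelInd (-1))).2, classProb_one] at h
  linarith

theorem hasMean_labelInd_inner (hρ : ∀ᵐ z ∂ρ, z ∈ goodSet d κ) (y : ℤ)
    (hy : classProb ρ y ≠ 0) (w : Vec d) :
    HasMean ρ (fun z => labelInd y z * inner ℝ w z.1)
      (classProb ρ y * inner ℝ w (classMean ρ y)) := by
  have hi := integrable_labelInd_smul hρ y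
  have h := integral_inner (𝕜 := ℝ) hi w
  have hI := hi.const_inner (𝕜 := ℝ) w
  simp only [inner_smul_right] at h hI
  refine ⟨hI, ?_⟩
  rw [h, ← classIntegral, classIntegral_eq y hy, inner_smul_right]

theorem abs_inner_le_of_mem {z : Sample d} (hz : z ∈ goodSet d κ) (w : Vec d) :
    |inner ℝ w z.1| ≤ ‖w‖ * κ :=
  (abs_real_inner_le_norm w z.1).trans (by gcongr; exact hz.1)

theorem abs_moment_integrand_le {z : Sample d} (hz : z ∈ goodSet d κ) (y : ℤ) (w h : Vec d) :
    |labelInd y z * (inner ℝ w z.1 * inner ℝ h z.1)| ≤ (‖w‖ * κ) * (‖h‖ * κ) := by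
  have hκ : 0 ≤ κ := (norm_nonneg _).trans hz.1
  rw [abs_mul, abs_mul]
  refine (mul_le_of_le_one_left (by positivity) (abs_labelInd_le y z)).trans ?_
  gcongr
  · exact abs_inner_le_of_mem hz w
  · exact abs_inner_le_of_mem hz h

theorem hasMean_moment (hρ : ∀ᵐ z ∂ρ, z ∈ goodSet d κ) (y : ℤ) (w h : Vec d) :
    HasMean ρ (fun z => labelInd y z * (inner ℝ w z.1 * inner ℝ h z.1))
      (classMoment ρ y w h) :=
  ⟨integrable_of_bound (by fun_prop) hρ fun z hz => abs_moment_integrand_le hz y w h, rfl⟩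

theorem classMoment_add_self (hρ : ∀ᵐ z ∂ρ, z ∈ goodSet d κ) (y : ℤ) (w h : Vec d) :
    classMoment ρ y (w + h) (w + h)
      = classMoment ρ y w w + 2 * classMoment ρ y w h + classMoment ρ y h h := by
  refine (HasMean.congr (((hasMean_moment hρ y w w).add
    ((hasMean_moment hρ y w h).const_mul 2)).add (hasMean_moment hρ y h h)) (fun z => ?_) rfl).2
  rw [inner_add_left]; ring

/-- The variance of `⟨h, x⟩` within a class is nonnegative. -/
theorem classMoment_self_ge (hρ : ∀ᵐ z ∂ρ, z ∈ goodSet d κ) (y : ℤ) (hy : classProb ρ y ≠ 0)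
    (h : Vec d) :
    classProb ρ y * inner ℝ h (classMean ρ y) ^ 2 ≤ classMoment ρ y h h := by
  have h1 := ((hasMean_moment hρ y h h).add (((hasMean_labelInd_inner hρ y hy h).const_mul
    (-2 * inner ℝ h (classMean ρ y))).add ((hasMean_labelInd y).const_mul
      (inner ℝ h (classMean ρ y) ^ 2)))).2
  have h2 : 0 ≤ ∫ z, labelInd y z * (inner ℝ h z.1 * inner ℝ h z.1)
      + (-2 * inner ℝ h (classMean ρ y) * (labelInd y z * inner ℝ h z.1)
        + inner ℝ h (classMean ρ y) ^ 2 * labelInd y z) ∂ρ := by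
    refine integral_nonneg fun z => ?_
    have := mul_nonneg (labelInd_nonneg y z)
      (sq_nonneg (inner ℝ h z.1 - inner ℝ h (classMean ρ y)))
    simp only [Pi.zero_apply]
    linarith
  rw [h1] at h2
  linarith

theorem classMoment_self_le (hρ : ∀ᵐ z ∂ρ, z ∈ goodSet d κ) (y : ℤ) (h : Vec d) :
    classMoment ρ y h h ≤ κ ^ 2 * ‖h‖ ^ 2 := by
  have h1 := hasMean_moment hρ y h h
  rw [← h1.2]
  calc _ ≤ ∫ _, κ ^ 2 * ‖h‖ ^ 2 ∂ρ := by
        refine integral_mono_ae h1.1 (integrable_const _) ?_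
        filter_upwards [hρ] with z hz
        refine (le_abs_self _).trans ((abs_moment_integrand_le hz y h h).trans (le_of_eq ?_))
        ring
    _ = _ := by simp

theorem norm_classMean_le (hρ : ∀ᵐ z ∂ρ, z ∈ goodSet d κ) (y : ℤ) (hy : 0 < classProb ρ y) :
    ‖classMean ρ y‖ ≤ κ := by
  have h1 : ‖classIntegral ρ y‖ ≤ κ * classProb ρ y := by
    have h2 := (hasMean_labelInd (ρ := ρ) y).const_mul κ
    rw [← h2.2]
    refine norm_integral_le_of_norm_le h2.1 ?_
    filter_upwards [hρ] with z hz
    rw [norm_smul, Real.norm_eq_abs, abs_of_nonneg (labelInd_nonneg y z), mul_comm]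
    gcongr
    · exact labelInd_nonneg y z
    · exact hz.1
  rw [classMean, norm_smul, norm_inv, Real.norm_eq_abs, abs_of_pos hy, inv_mul_le_iff₀ hy]
  linarith

/-- The gradient of the risk. -/
def riskGrad (ρ : Measure (Sample d)) (w : Vec d) : Vec d :=
  ∫ z, lossGrad (posProb ρ) (classMean ρ 1) (classMean ρ (-1)) w z ∂ρ

/-- The second-order part of the risk. -/
def riskQuad (ρ : Measure (Sample d)) (h : Vec d) : ℝ :=
  (1 - posProb ρ) * classMoment ρ 1 h h + posProb ρ * classMoment ρ (-1) h h
    - 2 * (posProb ρ * (1 - posProb ρ))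
      * (inner ℝ h (classMean ρ 1) * inner ℝ h (classMean ρ (-1)))

/-- The factor `p (1 - p)` is the mass of the conditioning event and cancels its normalization. The
remaining integrand, times the two label indicators, expands into products of a function of the
first draw and one of the second, so only class moments of order at most two survive. -/
theorem risk_eq (hρ : ∀ᵐ z ∂ρ, z ∈ goodSet d κ) (h0 : 0 < posProb ρ) (h1 : posProb ρ < 1)
    (w : Vec d) :
    risk ρ w = posProb ρ * (1 - posProb ρ)
        * (1 + 2 * inner ℝ w (classMean ρ (-1) - classMean ρ 1)) + riskQuad ρ w := by
  have hp := classProb_one (ρ := ρ)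
  have hn := classProb_neg_one hρ
  have hp0 : classProb ρ 1 ≠ 0 := by rw [hp]; exact h0.ne'
  have hn0 : classProb ρ (-1) ≠ 0 := by rw [hn]; exact (sub_pos.2 h1).ne'
  set s := {q : Sample d × Sample d | q.1.2 = 1 ∧ q.2.2 = -1} with hs
  have hprod : s = {z : Sample d | z.2 = 1} ×ˢ {z : Sample d | z.2 = -1} := rfl
  have hsm : MeasurableSet s := (measurableSet_label 1).prod (measurableSet_label (-1))
  have hμs : (ρ.prod ρ).real s = posProb ρ * (1 - posProb ρ) := by
    rw [hprod, measureReal_prod_prod, ← hn, classProb_eq_real]; rfl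
  have hcond : risk ρ w = ∫ q in s, (1 - inner ℝ w (q.1.1 - q.2.1)) ^ 2 ∂(ρ.prod ρ) := by
    rw [risk, ← hμs, ProbabilityTheory.cond, integral_smul_measure, smul_eq_mul, ENNReal.toReal_inv, ← mul_assoc,
      ← measureReal_def, mul_inv_cancel₀, one_mul]
    rw [hμs]
    exact (mul_pos h0 (sub_pos.2 h1)).ne'
  rw [hcond, ← integral_indicator hsm]
  have P0 := hasMean_labelInd (ρ := ρ) 1
  have N0 := hasMean_labelInd (ρ := ρ) (-1)
  have P1 := hasMean_labelInd_inner hρ 1 hp0 w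
  have N1 := hasMean_labelInd_inner hρ (-1) hn0 w
  have P2 := hasMean_moment hρ 1 w w
  have N2 := hasMean_moment hρ (-1) w w
  refine (HasMean.congr ((P0.prod N0).add ((P2.prod N0).add ((P0.prod N2).add
    (((P1.prod N0).const_mul (-2)).add (((P0.prod N1).const_mul 2).add
      ((P1.prod N1).const_mul (-2))))))) (fun q => ?_) ?_).2
  · by_cases hq1 : q.1.2 = 1 <;> by_cases hq2 : q.2.2 = -1 <;>
      simp [Set.indicator, hs, labelInd, hq1, hq2, inner_sub_right]
    ring
  · rw [hp, hn, riskQuad, inner_sub_right]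
    ring

theorem norm_lossGrad_le {p R : ℝ} {u v w : Vec d} {z : Sample d} (hp0 : 0 ≤ p) (hp1 : p ≤ 1)
    (hu : ‖u‖ ≤ κ) (hv : ‖v‖ ≤ κ) (hw : ‖w‖ ≤ R) (hz : z ∈ goodSet d κ) :
    ‖lossGrad p u v w z‖ ≤ 24 * R * κ ^ 2 + 4 * κ := by
  have hκ : 0 ≤ κ := (norm_nonneg _).trans hu
  have hR : 0 ≤ R := (norm_nonneg _).trans hw
  -- The gradient has three terms of the shape `(c ⟨w, a⟩) a` with `‖a‖ ≤ 2 κ` and `|c| ≤ 2`, each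
  -- contributing `8 R κ²`, and one term independent of `w`, contributing `4 κ`.
  have key : ∀ a : Vec d, ∀ c : ℝ, ‖a‖ ≤ 2 * κ → |c| ≤ 2 →
      ‖(c * inner ℝ w a) • a‖ ≤ 8 * R * κ ^ 2 := by
    intro a c ha hc
    rw [norm_smul, Real.norm_eq_abs, abs_mul]
    calc |c| * |inner ℝ w a| * ‖a‖ ≤ 2 * (R * (2 * κ)) * (2 * κ) := by
          gcongr
          exact (abs_real_inner_le_norm w a).trans (by gcongr)
      _ = _ := by ring
  have hxu : ‖z.1 - u‖ ≤ 2 * κ := (norm_sub_le _ _).trans (by linarith [hz.1])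
  have hxv : ‖z.1 - v‖ ≤ 2 * κ := (norm_sub_le _ _).trans (by linarith [hz.1])
  have hvu : ‖v - u‖ ≤ 2 * κ := (norm_sub_le _ _).trans (by linarith)
  have hpq : |2 * p * (1 - p)| ≤ 2 := by rw [abs_le]; constructor <;> nlinarith
  have h1 : ‖(2 * (1 - p) * inner ℝ w (z.1 - u) * (if z.2 = 1 then 1 else 0)) • (z.1 - u)‖
      ≤ 8 * R * κ ^ 2 := by
    rw [mul_right_comm]
    refine key _ _ hxu ?_
    split_ifs <;> rw [abs_le] <;> constructor <;> linarith
  have h2 : ‖(2 * p * inner ℝ w (z.1 - v) * (if z.2 = -1 then 1 else 0)) • (z.1 - v)‖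
      ≤ 8 * R * κ ^ 2 := by
    rw [mul_right_comm]
    refine key _ _ hxv ?_
    split_ifs <;> rw [abs_le] <;> constructor <;> linarith
  have h3 : ‖(2 * p * (1 - p)) • (v - u)‖ ≤ 4 * κ := by
    rw [norm_smul, Real.norm_eq_abs]
    calc _ ≤ 2 * (2 * κ) := by gcongr
      _ = _ := by ring
  have h4 := key (v - u) _ hvu hpq
  rw [lossGrad]
  refine (norm_add₄_le).trans ?_
  linarith

@[fun_prop]
theorem measurable_lossGrad {α : Type*} [MeasurableSpace α] {p : α → ℝ} {u v w : α → Vec d}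
    {z : α → Sample d} (hp : Measurable p) (hu : Measurable u) (hv : Measurable v)
    (hw : Measurable w) (hz : Measurable z) :
    Measurable fun a => lossGrad (p a) (u a) (v a) (w a) (z a) := by
  have h : ∀ y : ℤ, Measurable fun a => if (z a).2 = y then (1 : ℝ) else 0 := fun y =>
    (measurable_labelInd y).comp hz
  have h1 := h 1
  have h2 := h (-1)
  unfold lossGrad
  fun_prop

theorem integrable_lossGrad (hρ : ∀ᵐ z ∂ρ, z ∈ goodSet d κ) {p : ℝ} {u v : Vec d}
    (hp0 : 0 ≤ p) (hp1 : p ≤ 1) (hu : ‖u‖ ≤ κ) (hv : ‖v‖ ≤ κ) (w : Vec d) :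
    Integrable (lossGrad p u v w) ρ :=
  integrable_of_bound (Measurable.aestronglyMeasurable (by fun_prop)) hρ
    fun _ hz => norm_lossGrad_le hp0 hp1 hu hv le_rfl hz

theorem inner_riskGrad (hρ : ∀ᵐ z ∂ρ, z ∈ goodSet d κ) (h0 : 0 < posProb ρ)
    (h1 : posProb ρ < 1) (w h : Vec d) :
    inner ℝ h (riskGrad ρ w)
      = 2 * (1 - posProb ρ) * classMoment ρ 1 w h + 2 * posProb ρ * classMoment ρ (-1) w h
        + 2 * (posProb ρ * (1 - posProb ρ))
          * (inner ℝ h (classMean ρ (-1) - classMean ρ 1)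
            - inner ℝ w (classMean ρ (-1)) * inner ℝ h (classMean ρ 1)
            - inner ℝ w (classMean ρ 1) * inner ℝ h (classMean ρ (-1))) := by
  have hp := classProb_one (ρ := ρ)
  have hn := classProb_neg_one hρ
  have hp0 : 0 < classProb ρ 1 := by rw [hp]; exact h0
  have hn0 : 0 < classProb ρ (-1) := by rw [hn]; exact (sub_pos.2 h1)
  rw [riskGrad, ← integral_inner (𝕜 := ℝ) (integrable_lossGrad hρ h0.le h1.le
    (norm_classMean_le hρ 1 hp0) (norm_classMean_le hρ (-1) hn0) w)]
  set u := classMean ρ 1 with hu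
  set v := classMean ρ (-1) with hv
  set p := posProb ρ with hpdef
  have P0 := hasMean_labelInd (ρ := ρ) 1
  have N0 := hasMean_labelInd (ρ := ρ) (-1)
  have P1 := hasMean_labelInd_inner hρ 1 hp0.ne'
  have N1 := hasMean_labelInd_inner hρ (-1) hn0.ne'
  have P2 := hasMean_moment hρ 1 w h
  have N2 := hasMean_moment hρ (-1) w h
  refine (HasMean.congr ((P2.const_mul (2 * (1 - p))).add (((P1 w).const_mul
    (-2 * (1 - p) * inner ℝ h u)).add (((P1 h).const_mul (-2 * (1 - p) * inner ℝ w u)).add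
    ((P0.const_mul (2 * (1 - p) * (inner ℝ w u * inner ℝ h u))).add
    ((N2.const_mul (2 * p)).add (((N1 w).const_mul
    (-2 * p * inner ℝ h v)).add (((N1 h).const_mul (-2 * p * inner ℝ w v)).add
    ((N0.const_mul (2 * p * (inner ℝ w v * inner ℝ h v))).add
    (HasMean.const (2 * p * (1 - p) * (1 + inner ℝ w (v - u)) * inner ℝ h (v - u)))))))))))
    (fun z => ?_) ?_).2
  · simp only [lossGrad, inner_add_right, inner_smul_right, inner_sub_right, labelInd]
    ring
  · rw [hp, hn, ← hu, ← hv]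
    simp only [inner_sub_right]
    ring

/-- As `f` is a polynomial of degree two, the expansion is exact. It identifies the expected loss
gradient at the true `p, u, v` with the gradient of `f`, which is the reason for the form of the
loss. -/
theorem risk_add (hρ : ∀ᵐ z ∂ρ, z ∈ goodSet d κ) (h0 : 0 < posProb ρ) (h1 : posProb ρ < 1)
    (w h : Vec d) :
    risk ρ (w + h) = risk ρ w + inner ℝ h (riskGrad ρ w) + riskQuad ρ h := by
  rw [risk_eq hρ h0 h1, risk_eq hρ h0 h1, inner_riskGrad hρ h0 h1]
  simp only [riskQuad, classMoment_add_self hρ, inner_add_left, inner_sub_right]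
  ring

/-- The form is the sum of the weighted within-class variances of `⟨h, x⟩` and of `p (1 - p)` times
the squared difference of the two class means of `⟨h, x⟩`. -/
theorem riskQuad_nonneg (hρ : ∀ᵐ z ∂ρ, z ∈ goodSet d κ) (h0 : 0 < posProb ρ)
    (h1 : posProb ρ < 1) (h : Vec d) : 0 ≤ riskQuad ρ h := by
  have hp := classProb_one (ρ := ρ)
  have hn := classProb_neg_one hρ
  have hp0 : 0 < classProb ρ 1 := by rw [hp]; exact h0
  have hn0 : 0 < classProb ρ (-1) := by rw [hn]; exact (sub_pos.2 h1)
  have a := mul_le_mul_of_nonneg_left (classMoment_self_ge hρ 1 hp0.ne' h) hn0.le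
  have b := mul_le_mul_of_nonneg_left (classMoment_self_ge hρ (-1) hn0.ne' h) hp0.le
  have c := mul_nonneg (mul_nonneg hp0.le hn0.le)
    (sq_nonneg (inner ℝ h (classMean ρ 1) - inner ℝ h (classMean ρ (-1))))
  rw [hp, hn] at a b c
  rw [riskQuad]
  linarith

theorem riskQuad_le (hρ : ∀ᵐ z ∂ρ, z ∈ goodSet d κ) (h0 : 0 < posProb ρ)
    (h1 : posProb ρ < 1) (h : Vec d) : riskQuad ρ h ≤ 3 * κ ^ 2 * ‖h‖ ^ 2 := by
  have hp := classProb_one (ρ := ρ)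
  have hn := classProb_neg_one hρ
  have hp0 : 0 < classProb ρ 1 := by rw [hp]; exact h0
  have hn0 : 0 < classProb ρ (-1) := by rw [hn]; exact (sub_pos.2 h1)
  have a := mul_le_mul_of_nonneg_left (classMoment_self_le hρ 1 h) hn0.le
  have b := mul_le_mul_of_nonneg_left (classMoment_self_le hρ (-1) h) hp0.le
  have hi : ∀ y, 0 < classProb ρ y → |inner ℝ h (classMean ρ y)| ≤ ‖h‖ * κ := fun y hy =>
    (abs_real_inner_le_norm _ _).trans (by gcongr; exact norm_classMean_le hρ y hy)
  have c : |inner ℝ h (classMean ρ 1) * inner ℝ h (classMean ρ (-1))| ≤ κ ^ 2 * ‖h‖ ^ 2 := by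
    rw [abs_mul]
    refine (mul_le_mul (hi 1 hp0) (hi (-1) hn0) (abs_nonneg _)
      ((abs_nonneg _).trans (hi 1 hp0))).trans (le_of_eq (by ring))
  have c' := neg_le_of_abs_le c
  have hpq : 0 ≤ posProb ρ * (1 - posProb ρ) := mul_nonneg h0.le (by linarith)
  have hpq' : posProb ρ * (1 - posProb ρ) ≤ 1 := by nlinarith
  have e : 0 ≤ κ ^ 2 * ‖h‖ ^ 2 := by positivity
  rw [hp, hn] at *
  rw [riskQuad]
  nlinarith [mul_le_mul_of_nonneg_left c' hpq, mul_le_mul_of_nonneg_right hpq' e]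

end Objective

/-! ### The regularized objective -/

section Regularized

variable {d : ℕ}

/-- The gradient of the regularized objective. -/
def objGrad (ρ : Measure (Sample d)) (lam : ℝ) (w : Vec d) : Vec d := riskGrad ρ w + lam • w

/-- The second-order part of the regularized objective. -/
def objQuad (ρ : Measure (Sample d)) (lam : ℝ) (h : Vec d) : ℝ :=
  riskQuad ρ h + lam * ‖h‖ ^ 2 / 2

theorem isSubgradient_l2Reg {lam : ℝ} {w g : Vec d} (hg : IsSubgradient (l2Reg lam) w g)
    (hlam : 0 < lam) : g = lam • w := by
  -- The subgradient inequality is tested at a point where its linear gain is twice the quadratic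
  -- cost, which leaves `‖g - lam • w‖² / (2 lam) ≤ 0`.
  have h := hg (w + (1 / lam) • (g - lam • w))
  have e1 : ‖w + (1 / lam) • (g - lam • w)‖ ^ 2 = ‖w‖ ^ 2
      + 2 * (1 / lam) * inner ℝ w (g - lam • w) + (1 / lam) ^ 2 * ‖g - lam • w‖ ^ 2 := by
    rw [norm_add_sq_real, norm_smul, inner_smul_right, mul_pow, Real.norm_eq_abs, sq_abs]
    ring
  have e2 : inner ℝ g (g - lam • w) = ‖g - lam • w‖ ^ 2 + lam * inner ℝ w (g - lam • w) := by
    rw [← real_inner_self_eq_norm_sq]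
    conv_rhs => rw [inner_sub_left, real_inner_smul_left]
    ring
  rw [l2Reg, l2Reg, add_sub_cancel_left, inner_smul_right, e1, e2] at h
  have e3 : lam * (‖w‖ ^ 2 + 2 * (1 / lam) * inner ℝ w (g - lam • w)
      + (1 / lam) ^ 2 * ‖g - lam • w‖ ^ 2) / 2 = lam * ‖w‖ ^ 2 / 2
        + inner ℝ w (g - lam • w) + (1 / lam) * ‖g - lam • w‖ ^ 2 / 2 := by
    field_simp
  have e4 : 1 / lam * (‖g - lam • w‖ ^ 2 + lam * inner ℝ w (g - lam • w))
      = 1 / lam * ‖g - lam • w‖ ^ 2 + inner ℝ w (g - lam • w) := by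
    field_simp
  rw [e3, e4] at h
  have h2 : 1 / lam * ‖g - lam • w‖ ^ 2 ≤ 0 := by linarith
  have h3 : ‖g - lam • w‖ ^ 2 ≤ 0 := by
    by_contra! hc
    have : 0 < 1 / lam * ‖g - lam • w‖ ^ 2 := by positivity
    linarith
  have h4 : ‖g - lam • w‖ = 0 := by
    have := sq_nonneg ‖g - lam • w‖
    exact pow_eq_zero_iff two_ne_zero |>.1 (le_antisymm h3 this)
  exact sub_eq_zero.1 (norm_eq_zero.1 h4)

theorem selfBounding_l2Reg {lam : ℝ} (hlam : 0 < lam) :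
    SelfBounding (l2Reg (d := d) lam) (2 * lam) 0 := by
  intro w g hg
  rw [isSubgradient_l2Reg hg hlam, norm_smul, mul_pow, Real.norm_eq_abs, sq_abs, l2Reg]
  linarith

theorem convexityModulus_l2Reg {lam : ℝ} (hlam : 0 < lam) :
    ConvexityModulus (l2Reg (d := d) lam) lam := by
  intro w v g hg
  rw [isSubgradient_l2Reg hg hlam, norm_sub_sq_real, inner_smul_right, inner_sub_left,
    real_inner_self_eq_norm_sq, l2Reg, l2Reg]
  linarith

theorem iInf_objective {ρ : Measure (Sample d)} {lam : ℝ} {ws : Vec d}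
    (hws : ws ∈ minimizers (objective ρ (l2Reg lam))) :
    ⨅ v, objective ρ (l2Reg lam) v = objective ρ (l2Reg lam) ws := by
  refine le_antisymm (ciInf_le ⟨objective ρ (l2Reg lam) ws, ?_⟩ ws) (le_ciInf hws)
  rintro _ ⟨v, rfl⟩
  exact hws v

variable {ρ : Measure (Sample d)} {κ lam : ℝ} [IsProbabilityMeasure ρ]

theorem objective_add (hρ : ∀ᵐ z ∂ρ, z ∈ goodSet d κ) (h0 : 0 < posProb ρ) (h1 : posProb ρ < 1)
    (w h : Vec d) :
    objective ρ (l2Reg lam) (w + h)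
      = objective ρ (l2Reg lam) w + inner ℝ h (objGrad ρ lam w) + objQuad ρ lam h := by
  rw [objective, objective, risk_add hρ h0 h1, objGrad, objQuad, l2Reg, l2Reg, norm_add_sq_real,
    inner_add_right, inner_smul_right, real_inner_comm w h]
  ring

theorem objQuad_ge (hρ : ∀ᵐ z ∂ρ, z ∈ goodSet d κ) (h0 : 0 < posProb ρ) (h1 : posProb ρ < 1)
    (h : Vec d) : lam / 2 * ‖h‖ ^ 2 ≤ objQuad ρ lam h := by
  rw [objQuad]
  linarith [riskQuad_nonneg hρ h0 h1 h]

theorem objQuad_le (hρ : ∀ᵐ z ∂ρ, z ∈ goodSet d κ) (h0 : 0 < posProb ρ) (h1 : posProb ρ < 1)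
    (h : Vec d) : objQuad ρ lam h ≤ (3 * κ ^ 2 + lam / 2) * ‖h‖ ^ 2 := by
  rw [objQuad]
  linarith [riskQuad_le hρ h0 h1 h]

theorem continuous_objective (hρ : ∀ᵐ z ∂ρ, z ∈ goodSet d κ) (h0 : 0 < posProb ρ)
    (h1 : posProb ρ < 1) (hlam : 0 < lam) : Continuous (objective ρ (l2Reg lam)) := by
  rw [continuous_iff_continuousAt]
  intro w
  have hlim : Filter.Tendsto (fun v : Vec d => ‖v - w‖ * ‖objGrad ρ lam w‖
      + (3 * κ ^ 2 + lam / 2) * ‖v - w‖ ^ 2) (nhds w) (nhds 0) := by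
    have : Continuous fun v : Vec d => ‖v - w‖ * ‖objGrad ρ lam w‖
      + (3 * κ ^ 2 + lam / 2) * ‖v - w‖ ^ 2 := by fun_prop
    simpa using this.tendsto w
  rw [ContinuousAt, tendsto_iff_norm_sub_tendsto_zero]
  refine squeeze_zero (fun _ => norm_nonneg _) (fun v => ?_) hlim
  have e := objective_add hρ h0 h1 (lam := lam) w (v - w)
  rw [add_sub_cancel] at e
  have a := abs_le.1 (abs_real_inner_le_norm (v - w) (objGrad ρ lam w))
  have b := objQuad_le hρ h0 h1 (lam := lam) (v - w)
  have c := objQuad_ge hρ h0 h1 (lam := lam) (v - w)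
  have f : 0 ≤ lam / 2 * ‖v - w‖ ^ 2 := by positivity
  rw [Real.norm_eq_abs, abs_le, e]
  constructor <;> linarith

theorem exists_mem_minimizers (hρ : ∀ᵐ z ∂ρ, z ∈ goodSet d κ) (h0 : 0 < posProb ρ)
    (h1 : posProb ρ < 1) (hlam : 0 < lam) :
    ∃ ws, ws ∈ minimizers (objective ρ (l2Reg lam)) := by
  -- Outside this radius the term `lam / 2 * ‖v‖²` exceeds the linear one, so the value is at least
  -- that at the origin, and a minimizer over the ball is global.
  set r := 2 * ‖objGrad ρ lam 0‖ / lam with hr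
  have hr0 : 0 ≤ r := by positivity
  obtain ⟨ws, -, hws⟩ := (isCompact_closedBall (0 : Vec d) r).exists_isMinOn
    ⟨0, by simpa using hr0⟩ (continuous_objective hρ h0 h1 hlam).continuousOn
  refine ⟨ws, fun v => ?_⟩
  by_cases hv : v ∈ Metric.closedBall (0 : Vec d) r
  · exact hws hv
  · refine (hws (Metric.mem_closedBall_self hr0)).trans ?_
    have e := objective_add hρ h0 h1 (lam := lam) 0 v
    rw [zero_add] at e
    have a := abs_le.1 (abs_real_inner_le_norm v (objGrad ρ lam 0))
    have c := objQuad_ge hρ h0 h1 (lam := lam) v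
    have hv' : r < ‖v‖ := by simpa using hv
    rw [hr, div_lt_iff₀ hlam] at hv'
    nlinarith [norm_nonneg v]

variable {ws : Vec d}

theorem objGrad_eq_zero (hρ : ∀ᵐ z ∂ρ, z ∈ goodSet d κ) (h0 : 0 < posProb ρ)
    (h1 : posProb ρ < 1) (hlam : 0 < lam) (hws : ws ∈ minimizers (objective ρ (l2Reg lam))) :
    objGrad ρ lam ws = 0 := by
  set g := objGrad ρ lam ws with hg
  set L := 3 * κ ^ 2 + lam / 2 with hL
  have hLpos : 0 < L := by positivity
  -- A gradient step of length `1 / (2 L)` from `ws` would strictly decrease the objective if the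
  -- gradient were not zero.
  have a := hws (ws + (-(1 / (2 * L))) • g)
  rw [objective_add hρ h0 h1, ← hg, real_inner_smul_left, real_inner_self_eq_norm_sq] at a
  have b := objQuad_le hρ h0 h1 (lam := lam) ((-(1 / (2 * L))) • g)
  rw [norm_smul, mul_pow, Real.norm_eq_abs, sq_abs, ← hL] at b
  have e : L * ((-(1 / (2 * L))) ^ 2 * ‖g‖ ^ 2) = 1 / (2 * L) * ‖g‖ ^ 2 / 2 := by
    field_simp
  rw [e] at b
  by_contra hne
  have : 0 < 1 / (2 * L) * ‖g‖ ^ 2 := by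
    have := norm_pos_iff.2 hne
    positivity
  linarith

theorem objective_sub_minimum (hρ : ∀ᵐ z ∂ρ, z ∈ goodSet d κ) (h0 : 0 < posProb ρ)
    (h1 : posProb ρ < 1) (hlam : 0 < lam) (hws : ws ∈ minimizers (objective ρ (l2Reg lam)))
    (w : Vec d) :
    objective ρ (l2Reg lam) w - objective ρ (l2Reg lam) ws = objQuad ρ lam (w - ws) := by
  have e := objective_add hρ h0 h1 (lam := lam) ws (w - ws)
  rw [add_sub_cancel, objGrad_eq_zero hρ h0 h1 hlam hws, inner_zero_right] at e
  linarith

theorem eq_of_mem_minimizers (hρ : ∀ᵐ z ∂ρ, z ∈ goodSet d κ) (h0 : 0 < posProb ρ)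
    (h1 : posProb ρ < 1) (hlam : 0 < lam) (hws : ws ∈ minimizers (objective ρ (l2Reg lam)))
    {w : Vec d} (hw : w ∈ minimizers (objective ρ (l2Reg lam))) : w = ws := by
  have a := objective_sub_minimum hρ h0 h1 hlam hws w
  have b := objQuad_ge hρ h0 h1 (lam := lam) (w - ws)
  have c := hw ws
  by_contra hne
  have : 0 < lam / 2 * ‖w - ws‖ ^ 2 := by
    have := norm_pos_iff.2 (sub_ne_zero.2 hne)
    positivity
  linarith

theorem isProjection_minimizers (hρ : ∀ᵐ z ∂ρ, z ∈ goodSet d κ) (h0 : 0 < posProb ρ)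
    (h1 : posProb ρ < 1) (hlam : 0 < lam) (hws : ws ∈ minimizers (objective ρ (l2Reg lam)))
    (w : Vec d) : IsProjection (minimizers (objective ρ (l2Reg lam))) w ws :=
  ⟨hws, fun v hv => by rw [eq_of_mem_minimizers hρ h0 h1 hlam hws hv]⟩

theorem quadraticGrowth_objective (hρ : ∀ᵐ z ∂ρ, z ∈ goodSet d κ) (h0 : 0 < posProb ρ)
    (h1 : posProb ρ < 1) (hlam : 0 < lam) :
    QuadraticGrowth (objective ρ (l2Reg lam)) (lam / 2) := by
  obtain ⟨ws, hws⟩ := exists_mem_minimizers hρ h0 h1 hlam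
  refine fun w => ⟨ws, isProjection_minimizers hρ h0 h1 hlam hws w, ?_⟩
  rw [objective_sub_minimum hρ h0 h1 hlam hws]
  exact objQuad_ge hρ h0 h1 _

/-- The minimizer is unique and the excess of the objective is exactly `objQuad`, so quadratic
growth is a lower bound for this form in every direction. -/
theorem QuadraticGrowth.le_objQuad (hρ : ∀ᵐ z ∂ρ, z ∈ goodSet d κ) (h0 : 0 < posProb ρ)
    (h1 : posProb ρ < 1) (hlam : 0 < lam) (hws : ws ∈ minimizers (objective ρ (l2Reg lam)))
    {σ : ℝ} (hσ : QuadraticGrowth (objective ρ (l2Reg lam)) σ) (h : Vec d) :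
    σ * ‖h‖ ^ 2 ≤ objQuad ρ lam h := by
  obtain ⟨w', hw', hle⟩ := hσ (ws + h)
  obtain rfl := eq_of_mem_minimizers hρ h0 h1 hlam hws hw'.1
  rwa [objective_sub_minimum hρ h0 h1 hlam hws, add_sub_cancel_left] at hle

/-- Expand at `w` towards `ws` and at `ws` towards `w`, and use that the form is even. Convexity
alone would give half of this value; the factor 2 supplies the surplus in `descent_step`. -/
theorem inner_sub_objGrad (hρ : ∀ᵐ z ∂ρ, z ∈ goodSet d κ) (h0 : 0 < posProb ρ)
    (h1 : posProb ρ < 1) (hlam : 0 < lam) (hws : ws ∈ minimizers (objective ρ (l2Reg lam)))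
    (w : Vec d) :
    inner ℝ (w - ws) (objGrad ρ lam w) = 2 * objQuad ρ lam (w - ws) := by
  have a := objective_add hρ h0 h1 (lam := lam) w (ws - w)
  have b := objective_sub_minimum hρ h0 h1 hlam hws w
  have e : ∀ h : Vec d, objQuad ρ lam (-h) = objQuad ρ lam h := by
    intro h
    simp [objQuad, riskQuad, classMoment]
  rw [add_sub_cancel, ← neg_sub w ws, inner_neg_left, e] at a
  linarith

end Regularized

/-! ### The iterates as functions of the sequence of examples -/

section Iterates

variable {d : ℕ} {κ lam R : ℝ}

theorem card_labelled (y : ℕ → Sample d) (t : ℕ) (l : ℤ) :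
    ((labelled y t l).card : ℝ) = ∑ i ∈ Finset.range t, labelInd l (y i) := by
  rw [labelled, Finset.card_filter]
  push_cast
  rfl

theorem sum_labelled (y : ℕ → Sample d) (t : ℕ) (l : ℤ) :
    ∑ i ∈ labelled y t l, (y i).1 = ∑ i ∈ Finset.range t, labelInd l (y i) • (y i).1 := by
  simp [labelled, labelInd, Finset.sum_filter]

theorem dependsOnPast_empProb (t : ℕ) :
    DependsOnPast t fun y : ℕ → Sample d => empProb y t := by
  intro y y' h
  have e : labelled y t 1 = labelled y' t 1 :=
    Finset.filter_congr fun i hi => by rw [h i (Finset.mem_range.1 hi)]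
  simp only [empProb, e]

theorem dependsOnPast_empMean (t : ℕ) (l : ℤ) :
    DependsOnPast t fun y : ℕ → Sample d => empMean y t l := by
  intro y y' h
  have e : labelled y t l = labelled y' t l :=
    Finset.filter_congr fun i hi => by rw [h i (Finset.mem_range.1 hi)]
  simp only [empMean, e]
  congr 1
  exact Finset.sum_congr rfl fun i hi => by rw [h i (Finset.mem_range.1 (Finset.mem_filter.1 hi).1)]

@[fun_prop]
theorem measurable_empProb (t : ℕ) : Measurable fun y : ℕ → Sample d => empProb y t := by
  simp only [empProb, card_labelled]
  fun_prop

@[fun_prop]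
theorem measurable_empMean (t : ℕ) (l : ℤ) :
    Measurable fun y : ℕ → Sample d => empMean y t l := by
  simp only [empMean, card_labelled, sum_labelled]
  fun_prop

theorem empProb_nonneg (y : ℕ → Sample d) (t : ℕ) : 0 ≤ empProb y t := by
  unfold empProb; positivity

theorem empProb_le_one (y : ℕ → Sample d) (t : ℕ) : empProb y t ≤ 1 := by
  refine div_le_one_of_le₀ ?_ (by positivity)
  exact_mod_cast (Finset.card_filter_le _ _).trans (by simp)

theorem norm_empMean_le (hκ : 0 ≤ κ) {y : ℕ → Sample d} (hy : ∀ i, y i ∈ goodSet d κ) (t : ℕ)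
    (l : ℤ) : ‖empMean y t l‖ ≤ κ := by
  rw [empMean, norm_smul, norm_inv, Real.norm_natCast]
  rcases Nat.eq_zero_or_pos (labelled y t l).card with h | h
  · simp [h, hκ]
  · have : (0 : ℝ) < (labelled y t l).card := by exact_mod_cast h
    rw [inv_mul_le_iff₀ this, ← nsmul_eq_mul]
    exact norm_sum_le_of_le _ (fun i _ => (hy i).1) |>.trans (by simp)

/-- The stochastic gradient at the `k`-th step, with current observation `ζ`. -/
def sampleGrad (y : ℕ → Sample d) (k : ℕ) (w : Vec d) (ζ : Sample d) : Vec d :=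
  lossGrad (empProb y k) (empMean y k 1) (empMean y k (-1)) w ζ

/-- The iterates of the stochastic proximal gradient method, in closed form. -/
def proxIterate (η : ℕ → ℝ) (lam : ℝ) (y : ℕ → Sample d) : ℕ → Vec d
  | 0 => 0
  | k + 1 => (1 + η k * lam)⁻¹ •
      (proxIterate η lam y k - η k • sampleGrad y k (proxIterate η lam y k) (y k))

theorem dependsOnPast_sampleGrad (k : ℕ) :
    DependsOnPast k fun y : ℕ → Sample d => sampleGrad y k := by
  intro y y' h
  funext w ζ
  have e := dependsOnPast_empProb k y y' h
  have e1 := dependsOnPast_empMean k 1 y y' h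
  have e2 := dependsOnPast_empMean k (-1) y y' h
  simp only at e e1 e2
  simp only [sampleGrad, e, e1, e2]

theorem dependsOnPast_proxIterate (η : ℕ → ℝ) (lam : ℝ) (k : ℕ) :
    DependsOnPast k fun y : ℕ → Sample d => proxIterate η lam y k := by
  induction k with
  | zero => intro y y' _; rfl
  | succ k ih =>
    intro y y' h
    have h' : ∀ i < k, y i = y' i := fun i hi => h i (hi.trans (Nat.lt_succ_self k))
    have e1 := ih y y' h'
    have e2 := dependsOnPast_sampleGrad k y y' h'
    simp only at e1 e2
    simp only [proxIterate]
    rw [e1, e2, h k (Nat.lt_succ_self k)]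

@[fun_prop]
theorem measurable_sampleGrad {α : Type*} [MeasurableSpace α] (k : ℕ) {y : α → ℕ → Sample d}
    {w : α → Vec d} {ζ : α → Sample d} (hy : Measurable y) (hw : Measurable w)
    (hζ : Measurable ζ) : Measurable fun a => sampleGrad (y a) k (w a) (ζ a) := by
  have h1 := (measurable_empProb k).comp hy
  have h2 := (measurable_empMean k 1).comp hy
  have h3 := (measurable_empMean k (-1)).comp hy
  exact measurable_lossGrad h1 h2 h3 hw hζ

@[fun_prop]
theorem measurable_proxIterate (η : ℕ → ℝ) (lam : ℝ) (k : ℕ) :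
    Measurable fun y : ℕ → Sample d => proxIterate η lam y k := by
  induction k with
  | zero => exact measurable_const
  | succ k ih =>
    simp only [proxIterate]
    have h : Measurable fun y : ℕ → Sample d =>
        sampleGrad y k (proxIterate η lam y k) (y k) :=
      measurable_sampleGrad k measurable_id ih (measurable_pi_apply k)
    fun_prop

theorem norm_sampleGrad_le (hκ : 0 ≤ κ) {y : ℕ → Sample d} (hy : ∀ i, y i ∈ goodSet d κ) (k : ℕ)
    {w : Vec d} (hw : ‖w‖ ≤ R) {ζ : Sample d} (hζ : ζ ∈ goodSet d κ) :
    ‖sampleGrad y k w ζ‖ ≤ 24 * R * κ ^ 2 + 4 * κ :=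
  norm_lossGrad_le (empProb_nonneg y k) (empProb_le_one y k) (norm_empMean_le hκ hy k 1)
    (norm_empMean_le hκ hy k (-1)) hw hζ

/-- A gradient step with small step size increases the squared norm by at most `η / 2`, as the
loss is convex, smooth and nonnegative with value at most `1 / 4` at the origin. -/
theorem norm_sub_smul_lossGrad_sq_le {p η : ℝ} {u v w : Vec d} {z : Sample d} (hp0 : 0 ≤ p)
    (hp1 : p ≤ 1) (hu : ‖u‖ ≤ κ) (hv : ‖v‖ ≤ κ) (hz : z ∈ goodSet d κ) (hη : 0 ≤ η)
    (hηκ : η * (16 * κ ^ 2) ≤ 1) :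
    ‖w - η • lossGrad p u v w z‖ ^ 2 ≤ ‖w‖ ^ 2 + η / 2 := by
  have hκ : 0 ≤ κ := (norm_nonneg _).trans hu
  have key : ∀ (a b : Vec d) (c e : ℝ), ‖a‖ ≤ 2 * κ → ‖b‖ ≤ 2 * κ → 0 ≤ c → c ≤ 1 → 0 ≤ e →
      e ≤ 1 / 4 → ‖w - η • ((2 * c * inner ℝ w a) • a + (2 * e * (1 + inner ℝ w b)) • b)‖ ^ 2
        ≤ ‖w‖ ^ 2 + η / 2 := by
    intro a b c e ha hb hc0 hc1 he0 he1
    set A := inner ℝ w a with hA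
    set B := inner ℝ w b with hB
    set g := (2 * c * A) • a + (2 * e * (1 + B)) • b with hg
    have hwg : inner ℝ w g = 2 * c * A ^ 2 + 2 * e * (1 + B) * B := by
      rw [hg, inner_add_right, inner_smul_right, inner_smul_right, ← hA, ← hB]; ring
    have hg1 : ‖g‖ ≤ |2 * c * A| * (2 * κ) + |2 * e * (1 + B)| * (2 * κ) := by
      refine (norm_add_le _ _).trans ?_
      rw [norm_smul, norm_smul, Real.norm_eq_abs, Real.norm_eq_abs]
      gcongr
    have hg2 : ‖g‖ ^ 2 ≤ 32 * κ ^ 2 * (c ^ 2 * A ^ 2 + e ^ 2 * (1 + B) ^ 2) := by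
      calc ‖g‖ ^ 2 ≤ (|2 * c * A| * (2 * κ) + |2 * e * (1 + B)| * (2 * κ)) ^ 2 := by gcongr
        _ ≤ 2 * ((|2 * c * A| * (2 * κ)) ^ 2 + (|2 * e * (1 + B)| * (2 * κ)) ^ 2) := add_sq_le
        _ = _ := by rw [mul_pow, mul_pow |2 * e * (1 + B)|, sq_abs, sq_abs]; ring
    have hc2 : c ^ 2 * A ^ 2 ≤ c * A ^ 2 := by
      refine mul_le_mul_of_nonneg_right ?_ (sq_nonneg _); nlinarith
    have he2 : e ^ 2 * (1 + B) ^ 2 ≤ e * (1 + B) ^ 2 * (1 / 4) := by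
      -- The factor `1 / 4` comes from `e = p (1 - p) ≤ 1 / 4`. It keeps the squared gradient small
      -- compared with `⟨w, g⟩`.
      have : e ^ 2 ≤ e * (1 / 4) := by nlinarith
      nlinarith [mul_le_mul_of_nonneg_right this (sq_nonneg (1 + B))]
    have hm : η ^ 2 * ‖g‖ ^ 2 ≤ η * (2 * (c * A ^ 2 + e * (1 + B) ^ 2 * (1 / 4))) := by
      calc η ^ 2 * ‖g‖ ^ 2
          ≤ η ^ 2 * (32 * κ ^ 2 * (c * A ^ 2 + e * (1 + B) ^ 2 * (1 / 4))) := by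
            gcongr
            refine hg2.trans ?_
            gcongr
        _ = (η * (16 * κ ^ 2)) * (η * (2 * (c * A ^ 2 + e * (1 + B) ^ 2 * (1 / 4)))) := by ring
        _ ≤ 1 * (η * (2 * (c * A ^ 2 + e * (1 + B) ^ 2 * (1 / 4)))) := by gcongr
        _ = _ := one_mul _
    have hnorm : ‖w - η • g‖ ^ 2 = ‖w‖ ^ 2 - 2 * (η * inner ℝ w g) + η ^ 2 * ‖g‖ ^ 2 := by
      rw [norm_sub_sq_real, inner_smul_right, norm_smul, mul_pow, Real.norm_eq_abs, sq_abs]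
    rw [hnorm, hwg]
    have hfin : 2 * (c * A ^ 2 + e * (1 + B) ^ 2 * (1 / 4))
        - 2 * (2 * c * A ^ 2 + 2 * e * (1 + B) * B) ≤ 1 / 2 := by
      have h1 : 0 ≤ c * A ^ 2 := by positivity
      -- The polynomial is `(7 * B + 3) ^ 2 / 7`; it comes from completing the square in `(1 + B)² /
      -- 2 - 4 (1 + B) B`.
      have h2 : 0 ≤ e * (7 * B ^ 2 + 6 * B + 9 / 7) := by
        refine mul_nonneg he0 ?_
        nlinarith [sq_nonneg (7 * B + 3)]
      linarith
    linarith [mul_le_mul_of_nonneg_left hfin hη]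
  have hxu : ‖z.1 - u‖ ≤ 2 * κ := (norm_sub_le _ _).trans (by linarith [hz.1])
  have hxv : ‖z.1 - v‖ ≤ 2 * κ := (norm_sub_le _ _).trans (by linarith [hz.1])
  have hvu : ‖v - u‖ ≤ 2 * κ := (norm_sub_le _ _).trans (by linarith)
  have he0 : 0 ≤ p * (1 - p) := mul_nonneg hp0 (by linarith)
  have he1 : p * (1 - p) ≤ 1 / 4 := by nlinarith [sq_nonneg (p - 1 / 2)]
  rcases hz.2 with h | h
  · have := key _ _ (1 - p) _ hxu hvu (by linarith) (by linarith) he0 he1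
    convert this using 4
    simp only [lossGrad, h]
    norm_num
    module
  · have := key _ _ p _ hxv hvu hp0 hp1 he0 he1
    convert this using 4
    simp only [lossGrad, h]
    norm_num
    module

/-- The gradient step adds at most `η / 2` and the proximal map divides by `(1 + η lam)²`; the
radius `1 / (4 lam)` is preserved because `1 / (4 lam) + η / 2 ≤ (1 + η lam)² / (4 lam)`. -/
theorem norm_proxIterate_sq_le (hκ : 0 ≤ κ) (hlam : 0 < lam) {η : ℕ → ℝ} (hη : ∀ k, 0 ≤ η k)
    (hηκ : ∀ k, η k * (16 * κ ^ 2) ≤ 1) {y : ℕ → Sample d} (hy : ∀ i, y i ∈ goodSet d κ)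
    (k : ℕ) : ‖proxIterate η lam y k‖ ^ 2 ≤ 1 / (4 * lam) := by
  induction k with
  | zero => simp [proxIterate]; positivity
  | succ k ih =>
    have h1 := norm_sub_smul_lossGrad_sq_le (w := proxIterate η lam y k) (empProb_nonneg y k)
      (empProb_le_one y k) (norm_empMean_le hκ hy k 1) (norm_empMean_le hκ hy k (-1)) (hy k)
      (hη k) (hηκ k)
    have hpos : 0 < 1 + η k * lam := by have := mul_nonneg (hη k) hlam.le; linarith
    rw [proxIterate, norm_smul, mul_pow, norm_inv, Real.norm_eq_abs, inv_pow, sq_abs,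
      inv_mul_le_iff₀ (by positivity)]
    refine h1.trans ?_
    have e : (1 + η k * lam) ^ 2 * (1 / (4 * lam))
        = 1 / (4 * lam) + η k / 2 + η k ^ 2 * lam / 4 := by
      field_simp
      ring
    have : 0 ≤ η k ^ 2 * lam / 4 := by positivity
    linarith

/-- The implicit step in the regularizer is an explicit step along the full regularized gradient
with a smaller step size. The analysis can thus treat `φ` as one smooth function. -/
theorem proxIterate_succ {η : ℕ → ℝ} (y : ℕ → Sample d) {k : ℕ} (hη : 0 < 1 + η k * lam) :
    proxIterate η lam y (k + 1) = proxIterate η lam y k - (η k / (1 + η k * lam)) •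
      (sampleGrad y k (proxIterate η lam y k) (y k) + lam • proxIterate η lam y k) := by
  rw [proxIterate]
  have h : (1 + η k * lam)⁻¹ = 1 - η k / (1 + η k * lam) * lam := by
    field_simp
    ring
  rw [smul_sub, smul_smul, smul_add, smul_smul, div_eq_inv_mul]
  nth_rw 1 [h]
  rw [sub_smul, one_smul, div_eq_inv_mul]
  module

/-- Completing the square: the proximal objective exceeds its value at the claimed point by `(1 + η
lam) / 2` times the squared distance. -/
theorem eq_of_isMinimizer_prox {η : ℝ} (hη : 0 ≤ η) (hlam : 0 < lam) {w g w' : Vec d}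
    (h : ∀ v, η * inner ℝ (w' - w) g + η * l2Reg lam w' + 1 / 2 * ‖w' - w‖ ^ 2
      ≤ η * inner ℝ (v - w) g + η * l2Reg lam v + 1 / 2 * ‖v - w‖ ^ 2) :
    w' = (1 + η * lam)⁻¹ • (w - η • g) := by
  have hpos : 0 < 1 + η * lam := by have := mul_nonneg hη hlam.le; linarith
  set v := (1 + η * lam)⁻¹ • (w - η • g) with hv
  have hg : η • g = w - (1 + η * lam) • v := by
    rw [hv, smul_smul, mul_inv_cancel₀ hpos.ne', one_smul]; abel
  have e : ∀ a : Vec d, η * inner ℝ a g = inner ℝ a w - (1 + η * lam) * inner ℝ a v := by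
    intro a
    rw [← inner_smul_right, hg, inner_sub_right, inner_smul_right]
  have h1 := h v
  rw [e, e, l2Reg, l2Reg, norm_sub_sq_real, norm_sub_sq_real] at h1
  simp only [inner_sub_left, real_inner_self_eq_norm_sq] at h1
  have h2 : (1 + η * lam) * ‖w' - v‖ ^ 2 ≤ 0 := by
    rw [norm_sub_sq_real]
    linarith
  have h3 : ‖w' - v‖ ^ 2 ≤ 0 := by
    by_contra! hc
    have := mul_pos hpos hc
    linarith
  have h4 : ‖w' - v‖ = 0 := pow_eq_zero_iff two_ne_zero |>.1 (le_antisymm h3 (sq_nonneg _))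
  exact sub_eq_zero.1 (norm_eq_zero.1 h4)

theorem IsSPAUC.eq_proxIterate {η η' : ℕ → ℝ} (hη : ∀ k, 1 ≤ k → 0 ≤ η k) (h0 : η' 0 = 0)
    (hη' : ∀ k, 1 ≤ k → η' k = η k) (hlam : 0 < lam) {y : ℕ → Sample d} {w : ℕ → Vec d}
    (h : IsSPAUC η (l2Reg lam) y w) {t : ℕ} (ht : 1 ≤ t) : w t = proxIterate η' lam y t := by
  induction t, ht using Nat.le_induction with
  | base => rw [h.1]; simp [proxIterate, h0]
  | succ t ht ih =>
    have := eq_of_isMinimizer_prox (hη t ht) hlam (h.2 t ht)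
    rw [this, proxIterate, hη' t ht, ← ih]
    rfl

end Iterates

/-! ### Bias, noise and the descent inequality -/

section Descent

variable {d : ℕ} {κ lam R : ℝ} {ρ : Measure (Sample d)}

/-- The expected stochastic gradient at the `k`-th step. -/
def meanGrad (ρ : Measure (Sample d)) (y : ℕ → Sample d) (k : ℕ) (w : Vec d) : Vec d :=
  ∫ ζ, sampleGrad y k w ζ ∂ρ

/-- Lipschitz dependence on `(p, u, v)`, uniformly for `w` in a ball. It turns the estimation errors
of the class statistics into a bound for the bias. -/
theorem norm_lossGrad_sub_le {p p' : ℝ} {u u' v v' w : Vec d} {z : Sample d} (hκ : 1 ≤ κ)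
    (hp0 : 0 ≤ p) (hp1 : p ≤ 1) (hu : ‖u‖ ≤ κ) (hv : ‖v‖ ≤ κ) (hp0' : 0 ≤ p') (hp1' : p' ≤ 1)
    (hu' : ‖u'‖ ≤ κ) (hv' : ‖v'‖ ≤ κ) (hw : ‖w‖ ≤ R) (hz : z ∈ goodSet d κ) :
    ‖lossGrad p u v w z - lossGrad p' u' v' w z‖
      ≤ (24 * R * κ ^ 2 + 4 * κ) * (|p - p'| + ‖u - u'‖ + ‖v - v'‖) := by
  have hR : 0 ≤ R := (norm_nonneg _).trans hw
  have key : ∀ (a a' : Vec d) (c c' : ℝ), ‖a‖ ≤ 2 * κ → ‖a'‖ ≤ 2 * κ → |c'| ≤ 2 →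
      |c - c'| ≤ 2 * |p - p'| → ‖(c * inner ℝ w a) • a - (c' * inner ℝ w a') • a'‖
        ≤ 8 * R * κ ^ 2 * |p - p'| + 8 * R * κ * ‖a - a'‖ := by
    intro a a' c c' ha ha' hc' hcc
    have e : (c * inner ℝ w a) • a - (c' * inner ℝ w a') • a'
        = ((c - c') * inner ℝ w a) • a + ((c' * inner ℝ w (a - a')) • a
          + (c' * inner ℝ w a') • (a - a')) := by
      rw [inner_sub_right]; module
    have hi : ∀ b : Vec d, |inner ℝ w b| ≤ R * ‖b‖ := fun b =>
      (abs_real_inner_le_norm w b).trans (by gcongr)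
    rw [e]
    refine (norm_add_le _ _).trans ?_
    refine (add_le_add le_rfl (norm_add_le _ _)).trans ?_
    simp only [norm_smul, Real.norm_eq_abs, abs_mul]
    have t1 : |c - c'| * |inner ℝ w a| * ‖a‖ ≤ 2 * |p - p'| * (R * (2 * κ)) * (2 * κ) := by
      gcongr
      exact (hi a).trans (by gcongr)
    have t2 : |c'| * |inner ℝ w (a - a')| * ‖a‖ ≤ 2 * (R * ‖a - a'‖) * (2 * κ) := by
      gcongr
      exact hi _
    have t3 : |c'| * |inner ℝ w a'| * ‖a - a'‖ ≤ 2 * (R * (2 * κ)) * ‖a - a'‖ := by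
      gcongr
      exact (hi a').trans (by gcongr)
    linarith
  have sub_le : ∀ {a b : Vec d}, ‖a‖ ≤ κ → ‖b‖ ≤ κ → ‖a - b‖ ≤ 2 * κ := fun ha hb =>
    (norm_sub_le _ _).trans (by linarith)
  have hpp : |(1 - p) - (1 - p')| = |p - p'| := by rw [abs_sub_comm]; congr 1; ring
  have h0 : 0 ≤ |p - p'| := abs_nonneg _
  have t1 := key (z.1 - u) (z.1 - u') (2 * (1 - p) * if z.2 = 1 then 1 else 0)
    (2 * (1 - p') * if z.2 = 1 then 1 else 0) (sub_le hz.1 hu) (sub_le hz.1 hu')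
    (by split_ifs <;> rw [abs_le] <;> constructor <;> linarith)
    (by
      rw [← sub_mul, ← mul_sub, abs_mul, abs_mul, hpp]
      split_ifs <;> norm_num)
  have t2 := key (z.1 - v) (z.1 - v') (2 * p * if z.2 = -1 then 1 else 0)
    (2 * p' * if z.2 = -1 then 1 else 0) (sub_le hz.1 hv) (sub_le hz.1 hv')
    (by split_ifs <;> rw [abs_le] <;> constructor <;> linarith)
    (by
      rw [← sub_mul, ← mul_sub, abs_mul, abs_mul]
      split_ifs <;> norm_num)
  have hc' : |2 * p' * (1 - p')| ≤ 2 := by rw [abs_le]; constructor <;> nlinarith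
  have hcc : |2 * p * (1 - p) - 2 * p' * (1 - p')| ≤ 2 * |p - p'| := by
    have : 2 * p * (1 - p) - 2 * p' * (1 - p') = 2 * ((p - p') * (1 - p - p')) := by ring
    rw [this, abs_mul, abs_mul, abs_two]
    have : |1 - p - p'| ≤ 1 := by rw [abs_le]; constructor <;> linarith
    nlinarith
  have t4 := key (v - u) (v' - u') (2 * p * (1 - p)) (2 * p' * (1 - p')) (sub_le hv hu)
    (sub_le hv' hu') hc' hcc
  have hvu : ‖(v - u) - (v' - u')‖ ≤ ‖u - u'‖ + ‖v - v'‖ := by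
    have : (v - u) - (v' - u') = (v - v') - (u - u') := by abel
    rw [this, add_comm]
    exact norm_sub_le _ _
  have t3 : ‖(2 * p * (1 - p)) • (v - u) - (2 * p' * (1 - p')) • (v' - u')‖
      ≤ 4 * κ * |p - p'| + 2 * (‖u - u'‖ + ‖v - v'‖) := by
    have e : (2 * p * (1 - p)) • (v - u) - (2 * p' * (1 - p')) • (v' - u')
        = (2 * p * (1 - p) - 2 * p' * (1 - p')) • (v - u)
          + (2 * p' * (1 - p')) • ((v - u) - (v' - u')) := by module
    rw [e]
    refine (norm_add_le _ _).trans ?_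
    rw [norm_smul, norm_smul, Real.norm_eq_abs, Real.norm_eq_abs]
    calc _ ≤ 2 * |p - p'| * (2 * κ) + 2 * (‖u - u'‖ + ‖v - v'‖) := by
          gcongr
          exact sub_le hv hu
      _ = _ := by ring
  have e1 : ‖z.1 - u - (z.1 - u')‖ = ‖u - u'‖ := by
    rw [sub_sub_sub_cancel_left, norm_sub_rev]
  have e2 : ‖z.1 - v - (z.1 - v')‖ = ‖v - v'‖ := by
    rw [sub_sub_sub_cancel_left, norm_sub_rev]
  rw [e1, mul_right_comm _ (if z.2 = 1 then (1 : ℝ) else 0),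
    mul_right_comm _ (if z.2 = 1 then (1 : ℝ) else 0)] at t1
  rw [e2, mul_right_comm _ (if z.2 = -1 then (1 : ℝ) else 0),
    mul_right_comm _ (if z.2 = -1 then (1 : ℝ) else 0)] at t2
  rw [lossGrad, lossGrad, add_sub_add_comm, add_sub_add_comm, add_sub_add_comm]
  refine norm_add₄_le.trans ?_
  have t5 : 8 * R * κ * ‖(v - u) - (v' - u')‖ ≤ 8 * R * κ * (‖u - u'‖ + ‖v - v'‖) := by gcongr
  have hk : R * κ ≤ R * κ ^ 2 := by
    have : κ ≤ κ ^ 2 := by nlinarith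
    gcongr
  have a1 := mul_le_mul_of_nonneg_right hk (norm_nonneg (u - u'))
  have a2 := mul_le_mul_of_nonneg_right hk (norm_nonneg (v - v'))
  have a3 := mul_le_mul_of_nonneg_right hκ (norm_nonneg (u - u'))
  have a4 := mul_le_mul_of_nonneg_right hκ (norm_nonneg (v - v'))
  have a5 : 0 ≤ R * κ ^ 2 * ‖u - u'‖ := by positivity
  have a6 : 0 ≤ R * κ ^ 2 * ‖v - v'‖ := by positivity
  have a7 := norm_nonneg (u - u')
  have a8 := norm_nonneg (v - v')
  linarith

theorem norm_proxIterate_le (hκ : 0 ≤ κ) (hlam : 0 < lam) {η : ℕ → ℝ} (hη : ∀ k, 0 ≤ η k)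
    (hηκ : ∀ k, η k * (16 * κ ^ 2) ≤ 1) (hR : 1 / (4 * lam) ≤ R ^ 2) (hR0 : 0 ≤ R)
    {y : ℕ → Sample d} (hy : ∀ i, y i ∈ goodSet d κ) (k : ℕ) : ‖proxIterate η lam y k‖ ≤ R :=
  (sq_le_sq₀ (norm_nonneg _) hR0).1 ((norm_proxIterate_sq_le hκ hlam hη hηκ hy k).trans hR)

variable [IsProbabilityMeasure ρ]

theorem norm_meanGrad_le (hρ : ∀ᵐ z ∂ρ, z ∈ goodSet d κ) (hκ : 0 ≤ κ) {y : ℕ → Sample d}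
    (hy : ∀ i, y i ∈ goodSet d κ) (k : ℕ) {w : Vec d} (hw : ‖w‖ ≤ R) :
    ‖meanGrad ρ y k w‖ ≤ 24 * R * κ ^ 2 + 4 * κ := by
  refine (norm_integral_le_of_norm_le_const (μ := ρ) (C := 24 * R * κ ^ 2 + 4 * κ)
    (hρ.mono fun ζ hζ => norm_sampleGrad_le hκ hy k hw hζ)).trans (by simp)

theorem integrable_sampleGrad (hρ : ∀ᵐ z ∂ρ, z ∈ goodSet d κ) (hκ : 0 ≤ κ) {y : ℕ → Sample d}
    (hy : ∀ i, y i ∈ goodSet d κ) (k : ℕ) (w : Vec d) : Integrable (sampleGrad y k w) ρ :=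
  integrable_lossGrad hρ (empProb_nonneg y k) (empProb_le_one y k) (norm_empMean_le hκ hy k 1)
    (norm_empMean_le hκ hy k (-1)) w

theorem norm_meanGrad_sub_riskGrad_le (hρ : ∀ᵐ z ∂ρ, z ∈ goodSet d κ) (hκ : 1 ≤ κ)
    (h0 : 0 < posProb ρ) (h1 : posProb ρ < 1) {y : ℕ → Sample d}
    (hy : ∀ i, y i ∈ goodSet d κ) (k : ℕ) {w : Vec d} (hw : ‖w‖ ≤ R) :
    ‖meanGrad ρ y k w - riskGrad ρ w‖ ≤ (24 * R * κ ^ 2 + 4 * κ) *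
      (|empProb y k - posProb ρ| + ‖empMean y k 1 - classMean ρ 1‖
        + ‖empMean y k (-1) - classMean ρ (-1)‖) := by
  have hκ0 : 0 ≤ κ := by linarith
  have hu : ‖classMean ρ 1‖ ≤ κ := norm_classMean_le hρ 1 (by rwa [classProb_one])
  have hv : ‖classMean ρ (-1)‖ ≤ κ :=
    norm_classMean_le hρ (-1) (by rw [classProb_neg_one hρ]; linarith)
  rw [meanGrad, riskGrad, ← integral_sub (integrable_sampleGrad hρ hκ0 hy k w)
    (integrable_lossGrad hρ h0.le h1.le hu hv w)]
  refine (norm_integral_le_of_norm_le_const (μ := ρ) (hρ.mono fun ζ hζ =>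
    norm_lossGrad_sub_le hκ (empProb_nonneg y k) (empProb_le_one y k)
      (norm_empMean_le hκ0 hy k 1) (norm_empMean_le hκ0 hy k (-1)) h0.le h1.le hu hv hw
      hζ)).trans (by simp)

/-- The descent inequality for a gradient step of size `2 / (σ s)` along `a + ξ + b`, where `a` is
the gradient, `ξ` the noise and `b` the bias. -/
theorem descent_step {V : Type*} [NormedAddCommGroup V] [InnerProductSpace ℝ V]
    {σ s G B : ℝ} {Δ a ξ b : V} (hσ : 0 < σ) (hs : 1 ≤ s)
    (ha : 2 * σ * ‖Δ‖ ^ 2 ≤ inner ℝ Δ a) (hG : ‖a + ξ + b‖ ≤ G) (hB : ‖b‖ ^ 2 ≤ B) :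
    (s + 1) ^ 2 * ‖Δ - (2 / (σ * s)) • (a + ξ + b)‖ ^ 2
      ≤ s ^ 2 * ‖Δ‖ ^ 2 - 3 * s * ‖Δ‖ ^ 2 + 4 / σ * ((s + 1) ^ 2 / s) * inner ℝ Δ (-ξ)
        + 8 / σ ^ 2 * (s * B) + 16 / σ ^ 2 * G ^ 2 := by
  have hs0 : 0 < s := by linarith
  set γ := 2 / (σ * s) with hγ
  have hγ0 : 0 ≤ γ := by positivity
  have e : ‖Δ - γ • (a + ξ + b)‖ ^ 2 = ‖Δ‖ ^ 2 - 2 * γ * inner ℝ Δ a + 2 * γ * inner ℝ Δ (-ξ)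
      + 2 * γ * inner ℝ Δ (-b) + γ ^ 2 * ‖a + ξ + b‖ ^ 2 := by
    rw [norm_sub_sq_real, inner_smul_right, norm_smul, mul_pow, Real.norm_eq_abs, sq_abs,
      inner_add_right, inner_add_right, inner_neg_right, inner_neg_right]
    ring
  -- Young's inequality spends one `σ ‖Δ‖²` of the four available in `2 ⟨Δ, a⟩`, so three remain.
  have hb : 2 * inner ℝ Δ (-b) ≤ σ * ‖Δ‖ ^ 2 + B / σ := by
    have h1 := real_inner_le_norm Δ (-b)
    rw [norm_neg] at h1
    have h2 : 2 * (‖Δ‖ * ‖b‖) ≤ σ * ‖Δ‖ ^ 2 + ‖b‖ ^ 2 / σ := by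
      have : σ * ‖Δ‖ ^ 2 + ‖b‖ ^ 2 / σ - 2 * (‖Δ‖ * ‖b‖) = (σ * ‖Δ‖ - ‖b‖) ^ 2 / σ := by
        field_simp; ring
      have h3 : 0 ≤ (σ * ‖Δ‖ - ‖b‖) ^ 2 / σ := by positivity
      linarith
    have h3 : ‖b‖ ^ 2 / σ ≤ B / σ := by gcongr
    linarith
  have hG2 : ‖a + ξ + b‖ ^ 2 ≤ G ^ 2 := by gcongr
  have hB0 : 0 ≤ B := (sq_nonneg _).trans hB
  have step : ‖Δ - γ • (a + ξ + b)‖ ^ 2 ≤ (1 - 3 * (γ * σ)) * ‖Δ‖ ^ 2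
      + 2 * γ * inner ℝ Δ (-ξ) + γ * (B / σ) + γ ^ 2 * G ^ 2 := by
    rw [e]
    have t1 := mul_le_mul_of_nonneg_left ha hγ0
    have t2 := mul_le_mul_of_nonneg_left hb hγ0
    have t3 := mul_le_mul_of_nonneg_left hG2 (sq_nonneg γ)
    linarith
  have h4 : (s + 1) ^ 2 ≤ 4 * s ^ 2 := by nlinarith
  -- Of the coefficient `s² - 4 s - 11 - 6 / s`, the `s²` telescopes and `-3 s` is kept to absorb
  -- the compensator of the noise.
  have c1 : (s + 1) ^ 2 * (1 - 3 * (γ * σ)) ≤ s ^ 2 - 3 * s := by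
    have : γ * σ = 2 / s := by rw [hγ]; field_simp
    rw [this]
    have : (s + 1) ^ 2 * (1 - 3 * (2 / s)) = s ^ 2 - 4 * s - 11 - 6 / s := by
      field_simp; ring
    rw [this]
    have : 0 ≤ 6 / s := by positivity
    linarith
  have c2 : (s + 1) ^ 2 * (2 * γ) = 4 / σ * ((s + 1) ^ 2 / s) := by
    rw [hγ]; field_simp; ring
  have c3 : (s + 1) ^ 2 * (γ * (B / σ)) ≤ 8 / σ ^ 2 * (s * B) := by
    calc (s + 1) ^ 2 * (γ * (B / σ)) ≤ 4 * s ^ 2 * (γ * (B / σ)) := by gcongr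
      _ = _ := by rw [hγ]; field_simp; ring
  have c4 : (s + 1) ^ 2 * (γ ^ 2 * G ^ 2) ≤ 16 / σ ^ 2 * G ^ 2 := by
    calc (s + 1) ^ 2 * (γ ^ 2 * G ^ 2) ≤ 4 * s ^ 2 * (γ ^ 2 * G ^ 2) := by gcongr
      _ = _ := by rw [hγ]; field_simp; ring
  calc _ ≤ (s + 1) ^ 2 * ((1 - 3 * (γ * σ)) * ‖Δ‖ ^ 2
      + 2 * γ * inner ℝ Δ (-ξ) + γ * (B / σ) + γ ^ 2 * G ^ 2) := by gcongr
    _ = (s + 1) ^ 2 * (1 - 3 * (γ * σ)) * ‖Δ‖ ^ 2 + (s + 1) ^ 2 * (2 * γ) * inner ℝ Δ (-ξ)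
        + (s + 1) ^ 2 * (γ * (B / σ)) + (s + 1) ^ 2 * (γ ^ 2 * G ^ 2) := by ring
    _ ≤ _ := by
        rw [c2]
        have := mul_le_mul_of_nonneg_right c1 (sq_nonneg ‖Δ‖)
        linarith

/-- The noise terms of the descent inequality, weighted by `m k`. -/
theorem isIncrement_noise (hρ : ∀ᵐ z ∂ρ, z ∈ goodSet d κ) (hκ : 0 ≤ κ) (hlam : 0 < lam)
    {η : ℕ → ℝ} (hη : ∀ k, 0 ≤ η k) (hηκ : ∀ k, η k * (16 * κ ^ 2) ≤ 1)
    (hR : 1 / (4 * lam) ≤ R ^ 2) (hR0 : 0 ≤ R) (ws : Vec d) {m : ℕ → ℝ} (hm : ∀ k, 0 ≤ m k) :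
    IsIncrement ρ (goodSet d κ)
      (fun k y ζ => m k * inner ℝ (proxIterate η lam y k - ws)
        (meanGrad ρ y k (proxIterate η lam y k) - sampleGrad y k (proxIterate η lam y k) ζ))
      (fun k y => m k * (2 * (24 * R * κ ^ 2 + 4 * κ) * ‖proxIterate η lam y k - ws‖)) := by
  have hmean : ∀ k, Measurable fun y : ℕ → Sample d =>
      meanGrad ρ y k (proxIterate η lam y k) := fun k => by
    have : Measurable fun q : (ℕ → Sample d) × Sample d =>
        sampleGrad q.1 k (proxIterate η lam q.1 k) q.2 :=
      measurable_sampleGrad k measurable_fst ((measurable_proxIterate η lam k).comp measurable_fst)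
        measurable_snd
    exact (this.stronglyMeasurable.integral_prod_right' (ν := ρ)).measurable
  have hRk : ∀ {y : ℕ → Sample d}, (∀ i, y i ∈ goodSet d κ) → ∀ k, ‖proxIterate η lam y k‖ ≤ R :=
    fun hy k => norm_proxIterate_le hκ hlam hη hηκ hR hR0 hy k
  constructor
  · intro k
    have h1 : Measurable fun q : (ℕ → Sample d) × Sample d =>
        sampleGrad q.1 k (proxIterate η lam q.1 k) q.2 :=
      measurable_sampleGrad k measurable_fst ((measurable_proxIterate η lam k).comp measurable_fst)
        measurable_snd
    have h2 : Measurable fun q : (ℕ → Sample d) × Sample d =>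
        meanGrad ρ q.1 k (proxIterate η lam q.1 k) := (hmean k).comp measurable_fst
    have h3 : Measurable fun q : (ℕ → Sample d) × Sample d => proxIterate η lam q.1 k :=
      (measurable_proxIterate η lam k).comp measurable_fst
    exact ((h3.sub_const ws).inner (h2.sub h1)).const_mul (m k)
  · intro k
    fun_prop
  · intro k y y' h
    have e1 := dependsOnPast_sampleGrad k y y' h
    have e2 := dependsOnPast_proxIterate η lam k y y' h
    simp only at e1 e2
    funext ζ
    simp only [meanGrad, e1, e2]
  · intro k y y' h
    have e2 := dependsOnPast_proxIterate η lam k y y' h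
    simp only at e2
    simp only [e2]
  · intro k y hy ζ hζ
    rw [abs_mul, abs_of_nonneg (hm k)]
    refine mul_le_mul_of_nonneg_left ((abs_real_inner_le_norm _ _).trans ?_) (hm k)
    rw [mul_comm]
    gcongr
    refine (norm_sub_le _ _).trans ?_
    have a := norm_meanGrad_le hρ hκ hy k (hRk hy k)
    have b := norm_sampleGrad_le hκ hy k (hRk hy k) hζ
    linarith
  · intro k y hy
    have hi := integrable_sampleGrad hρ hκ hy k (proxIterate η lam y k)
    have hi' : Integrable (fun ζ => meanGrad ρ y k (proxIterate η lam y k)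
        - sampleGrad y k (proxIterate η lam y k) ζ) ρ := (integrable_const _).sub hi
    rw [integral_const_mul, integral_inner (𝕜 := ℝ) hi', integral_sub (integrable_const _) hi]
    simp [meanGrad]

end Descent

/-! ### Concentration of the empirical class probabilities and class means -/

section Means

variable {S : Type*} [MeasurableSpace S] {d : ℕ} {κ : ℝ} {ρ : Measure (Sample d)}
  {P : Measure S} {z : ℕ → S → Sample d}

theorem isIncrement_centred {E : Type*} [MeasurableSpace E] {ρ : Measure E}
    [IsProbabilityMeasure ρ] {K : Set E} (hKρ : ∀ᵐ x ∂ρ, x ∈ K) {g : E → ℝ} (hg : Measurable g)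
    {B : ℝ} (hB : ∀ x ∈ K, |g x| ≤ B) (θ : ℝ) :
    IsIncrement ρ K (fun _ _ x => θ * (g x - ∫ x', g x' ∂ρ)) (fun _ _ => |θ| * (2 * B)) where
  measurable _ := ((hg.comp measurable_snd).sub_const _).const_mul θ
  measurable_bound _ := measurable_const
  past _ _ _ _ := rfl
  past_bound _ _ _ _ := rfl
  abs_le _ _ _ x hx := by
    have h : |∫ x', g x' ∂ρ| ≤ B := by
      simpa using norm_integral_le_of_norm_le_const (μ := ρ) (f := g) (C := B) (hKρ.mono hB)
    rw [abs_mul]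
    gcongr
    exact (abs_sub _ _).trans (by linarith [hB x hx])
  integral_eq _ _ _ := by
    have hi : Integrable g ρ := Integrable.of_bound hg.aestronglyMeasurable B (hKρ.mono hB)
    rw [integral_const_mul, integral_sub hi (integrable_const _)]
    simp

theorem measure_abs_mean_sub_gt_le {E : Type*} [MeasurableSpace E] {ρ : Measure E}
    [IsProbabilityMeasure P] {K : Set E} (hKm : MeasurableSet K) (hK : K.Nonempty)
    (hKρ : ∀ᵐ x ∂ρ, x ∈ K) {z : ℕ → S → E} (hz : ∀ t, Measurable (z t))
    (hρ : ∀ t, P.map (z t) = ρ) (hind : iIndepFun z P) {g : E → ℝ} (hg : Measurable g) {B : ℝ}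
    (hB0 : 0 < B) (hB : ∀ x ∈ K, |g x| ≤ B) {t : ℕ} (ht : 1 ≤ t) {L : ℝ} (hL : 0 < L) :
    P {s | 3 * B * √(L / t) < |(∑ k ∈ Finset.range t, g (z k s)) / t - ∫ x, g x ∂ρ|}
      ≤ 2 * ENNReal.ofReal (Real.exp (-L)) := by
  have : IsProbabilityMeasure ρ := by
    rw [← hρ 0]; exact Measure.isProbabilityMeasure_map (hz 0).aemeasurable
  have ht0 : (0 : ℝ) < t := by exact_mod_cast ht
  set r := √(L / t) with hr
  have hr0 : 0 < r := Real.sqrt_pos.2 (by positivity)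
  have hr2 : r ^ 2 * t = L := by
    rw [hr, Real.sq_sqrt (by positivity)]; field_simp
  set e := ∫ x, g x ∂ρ with he
  have hsum : ∀ (θ : ℝ) (s : S), ∑ k ∈ Finset.range t,
      (θ * (g (z k s) - e) - (|θ| * (2 * B)) ^ 2 / 2)
        = t * (θ * ((∑ k ∈ Finset.range t, g (z k s)) / t - e) - 2 * θ ^ 2 * B ^ 2) := by
    intro θ s
    rw [Finset.sum_sub_distrib, ← Finset.mul_sum, Finset.sum_sub_distrib, mul_pow, sq_abs]
    simp only [Finset.sum_const, Finset.card_range, nsmul_eq_mul]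
    field_simp
  -- The exponential parameter is `r / B`: a deviation of `3 B r` contributes `3 r²` per term and
  -- the compensator takes away `2 r²`, which leaves `t r² = L`. The opposite sign gives the other
  -- tail.
  have hp := (isIncrement_centred hKρ hg hB (r / B)).measure_sum_ge_le hKm hK hKρ hz hρ hind t L
  have hn := (isIncrement_centred hKρ hg hB (-(r / B))).measure_sum_ge_le hKm hK hKρ hz hρ hind
    t L
  rw [two_mul]
  refine (measure_mono ?_).trans ((measure_union_le _ _).trans (add_le_add hp hn))
  intro s hs
  simp only [Set.mem_ofPred_eq, Set.mem_union] at hs ⊢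
  rw [hsum, hsum]
  have key : ∀ x : ℝ, 3 * B * r < x → L ≤ t * (r / B * x - 2 * (r / B) ^ 2 * B ^ 2) := by
    intro x hx
    have h1 : r / B * (3 * B * r) ≤ r / B * x := by gcongr
    have h2 : r / B * (3 * B * r) = 3 * r ^ 2 := by field_simp
    have h3 : (r / B) ^ 2 * B ^ 2 = r ^ 2 := by field_simp
    rw [← hr2, mul_comm, mul_assoc 2, h3]
    gcongr
    linarith
  rcases lt_abs.1 hs with h | h
  · exact Or.inl (key _ h)
  · right
    have := key _ h
    rw [neg_sq]
    linarith

/-- The test functions whose means determine the class probabilities and the class means: the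
indicator function of a label, and its products with the coordinates of the input. -/
def testFun (l : ℤ) : Option (Fin d) → Sample d → ℝ
  | none, z => labelInd l z
  | some i, z => labelInd l z * z.1 i

theorem measurable_testFun (l : ℤ) (o : Option (Fin d)) : Measurable (testFun l o) := by
  cases o with
  | none => exact measurable_labelInd l
  | some i =>
    have h : Measurable fun z : Sample d => z.1 i :=
      (EuclideanSpace.proj (𝕜 := ℝ) i).measurable.comp measurable_fst
    exact (measurable_labelInd l).mul h

theorem abs_testFun_le (hκ : 1 ≤ κ) (l : ℤ) (o : Option (Fin d)) {z : Sample d}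
    (hz : z ∈ goodSet d κ) : |testFun l o z| ≤ κ := by
  cases o with
  | none => exact (abs_labelInd_le l z).trans hκ
  | some i =>
    simp only [testFun]
    rw [abs_mul]
    exact (mul_le_of_le_one_left (abs_nonneg _) (abs_labelInd_le l z)).trans
      ((PiLp.norm_apply_le z.1 i).trans hz.1)

theorem norm_le_of_forall_abs_le {x : Vec d} {r : ℝ} (hr : 0 ≤ r) (h : ∀ i, |x i| ≤ r) :
    ‖x‖ ≤ d * r := by
  refine (sq_le_sq₀ (norm_nonneg _) (by positivity)).1 ?_
  rw [EuclideanSpace.norm_sq_eq]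
  calc ∑ i, ‖x i‖ ^ 2 ≤ ∑ _i : Fin d, r ^ 2 := by
        gcongr with i
        exact h i
    _ = d * r ^ 2 := by simp
    _ ≤ (d : ℝ) ^ 2 * r ^ 2 := by
        gcongr
        exact_mod_cast Nat.le_self_pow two_ne_zero d
    _ = _ := by ring

theorem abs_empProb_sub_le {y : ℕ → Sample d} {t : ℕ} {r : ℝ}
    (h : |(∑ k ∈ Finset.range t, testFun 1 none (y k)) / t - ∫ x, testFun 1 none x ∂ρ| ≤ r) :
    |empProb y t - posProb ρ| ≤ r := by
  rw [empProb, card_labelled, ← classProb_one]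
  exact h

variable [IsProbabilityMeasure ρ]

/-- The empirical mean is a ratio, but multiplied by the empirical frequency `q` it is an ordinary
average, and it is always bounded by `κ`. Hence only the true class probability is divided by, and
the bound holds even when the class has not yet been seen. -/
theorem norm_empMean_sub_le (hρ : ∀ᵐ z ∂ρ, z ∈ goodSet d κ) (hκ : 0 ≤ κ) {y : ℕ → Sample d}
    (hy : ∀ i, y i ∈ goodSet d κ) {t : ℕ} {r : ℝ} {l : ℤ} (hl : 0 < classProb ρ l)
    (h : ∀ o, |(∑ k ∈ Finset.range t, testFun l o (y k)) / t - ∫ x, testFun l o x ∂ρ| ≤ r) :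
    ‖empMean y t l - classMean ρ l‖ ≤ (κ + d) / classProb ρ l * r := by
  have hr : 0 ≤ r := (abs_nonneg _).trans (h none)
  set q := (∑ k ∈ Finset.range t, labelInd l (y k)) / t with hq
  have h0 : |q - classProb ρ l| ≤ r := h none
  have hvec : ‖(t : ℝ)⁻¹ • ∑ k ∈ Finset.range t, labelInd l (y k) • (y k).1
      - classIntegral ρ l‖ ≤ d * r := by
    refine norm_le_of_forall_abs_le hr fun i => ?_
    have h1 := h (some i)
    have h2 : classIntegral ρ l i = ∫ x, testFun l (some i) x ∂ρ :=
      ((EuclideanSpace.proj (𝕜 := ℝ) i).integral_comp_comm (integrable_labelInd_smul hρ l)).symm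
    rw [← h2] at h1
    convert h1 using 2
    simp [testFun, div_eq_inv_mul]
  have hq2 : q • empMean y t l
      = (t : ℝ)⁻¹ • ∑ k ∈ Finset.range t, labelInd l (y k) • (y k).1 := by
    rw [empMean, sum_labelled, card_labelled, hq, smul_smul, div_eq_inv_mul, mul_assoc]
    by_cases hc : ∑ k ∈ Finset.range t, labelInd l (y k) = 0
    · have hz : ∀ k ∈ Finset.range t, labelInd l (y k) • (y k).1 = 0 := fun k hk => by
        rw [(Finset.sum_eq_zero_iff_of_nonneg fun k _ => labelInd_nonneg l (y k)).1 hc k hk,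
          zero_smul]
      rw [Finset.sum_eq_zero hz, smul_zero, smul_zero]
    · rw [mul_inv_cancel₀ hc, mul_one]
  have e : classProb ρ l • (empMean y t l - classMean ρ l)
      = -((q - classProb ρ l) • empMean y t l)
        + ((t : ℝ)⁻¹ • ∑ k ∈ Finset.range t, labelInd l (y k) • (y k).1
          - classIntegral ρ l) := by
    rw [← hq2, classIntegral_eq l hl.ne']
    module
  have hn : classProb ρ l * ‖empMean y t l - classMean ρ l‖ ≤ r * κ + d * r := by
    rw [← abs_of_pos hl, ← Real.norm_eq_abs, ← norm_smul, e]
    refine (norm_add_le _ _).trans (add_le_add ?_ hvec)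
    rw [norm_neg, norm_smul]
    exact mul_le_mul h0 (norm_empMean_le hκ hy t l) (norm_nonneg _) hr
  rw [div_mul_eq_mul_div, le_div_iff₀ hl]
  linarith

end Means

/-! ### Summation of the descent inequalities -/

section Summation

variable {d : ℕ} {κ lam R σ : ℝ} {ρ : Measure (Sample d)}

theorem sum_inv_le_one_add_log (t : ℕ) :
    ∑ k ∈ Finset.range t, 1 / ((k : ℝ) + 1) ≤ 1 + Real.log t := by
  have h := harmonic_le_one_add_log t
  rw [harmonic] at h
  push_cast at h
  simpa [one_div] using h

theorem le_of_descent {E r : ℕ → ℝ} (t : ℕ)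
    (h : ∀ k < t, E (k + 2) ≤ E (k + 1) + r k) : E (t + 1) ≤ E 1 + ∑ k ∈ Finset.range t, r k := by
  induction t with
  | zero => simp
  | succ t ih =>
    rw [Finset.sum_range_succ]
    have h1 := ih fun k hk => h k (hk.trans (Nat.lt_succ_self t))
    have h2 := h t (Nat.lt_succ_self t)
    linarith

variable [IsProbabilityMeasure ρ]

theorem descent_proxIterate (hρ : ∀ᵐ z ∂ρ, z ∈ goodSet d κ) (hκ : 0 ≤ κ) (h0 : 0 < posProb ρ)
    (h1 : posProb ρ < 1) (hlam : 0 < lam) {ws : Vec d}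
    (hws : ws ∈ minimizers (objective ρ (l2Reg lam))) (hσ : 0 < σ)
    (hgrow : QuadraticGrowth (objective ρ (l2Reg lam)) σ) {η : ℕ → ℝ} (hη : ∀ k, 0 ≤ η k)
    {y : ℕ → Sample d} (hy : ∀ i, y i ∈ goodSet d κ) {k : ℕ} (hR : ‖proxIterate η lam y k‖ ≤ R)
    {s B : ℝ} (hs : 1 ≤ s) (hstep : η k / (1 + η k * lam) = 2 / (σ * s))
    (hB : ‖meanGrad ρ y k (proxIterate η lam y k) - riskGrad ρ (proxIterate η lam y k)‖ ^ 2
      ≤ B) :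
    (s + 1) ^ 2 * ‖proxIterate η lam y (k + 1) - ws‖ ^ 2
      ≤ s ^ 2 * ‖proxIterate η lam y k - ws‖ ^ 2 - 3 * s * ‖proxIterate η lam y k - ws‖ ^ 2
        + 4 / σ * ((s + 1) ^ 2 / s) * inner ℝ (proxIterate η lam y k - ws)
          (meanGrad ρ y k (proxIterate η lam y k) - sampleGrad y k (proxIterate η lam y k) (y k))
        + 8 / σ ^ 2 * (s * B) + 16 / σ ^ 2 * (24 * R * κ ^ 2 + 4 * κ + lam * R) ^ 2 := by
  have hpos : 0 < 1 + η k * lam := by have := mul_nonneg (hη k) hlam.le; linarith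
  have hsucc := proxIterate_succ y hpos
  set w := proxIterate η lam y k with hw
  set g := sampleGrad y k w (y k) with hg
  set m := meanGrad ρ y k w with hm
  have e : objGrad ρ lam w + (g - m) + (m - riskGrad ρ w) = g + lam • w := by
    rw [objGrad]; abel
  have ha : 2 * σ * ‖w - ws‖ ^ 2 ≤ inner ℝ (w - ws) (objGrad ρ lam w) := by
    rw [inner_sub_objGrad hρ h0 h1 hlam hws]
    linarith [hgrow.le_objQuad hρ h0 h1 hlam hws (w - ws)]
  have hG : ‖objGrad ρ lam w + (g - m) + (m - riskGrad ρ w)‖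
      ≤ 24 * R * κ ^ 2 + 4 * κ + lam * R := by
    rw [e]
    refine (norm_add_le _ _).trans (add_le_add (norm_sampleGrad_le hκ hy k hR (hy k)) ?_)
    rw [norm_smul, Real.norm_eq_abs, abs_of_pos hlam]
    gcongr
  have := descent_step hσ hs ha hG hB
  rw [neg_sub, e, ← hstep] at this
  rw [hsucc, sub_right_comm]
  exact this

/-- The weights of the noise terms for the horizon `t`. -/
def noiseWeight (σ K b : ℝ) (t k : ℕ) : ℝ :=
  if k = 0 then 0 else
    3 * σ ^ 2 / (512 * K ^ 2 * (t + b)) * (4 / σ * ((k + b + 1) ^ 2 / (k + b)))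

theorem noiseWeight_nonneg {K b : ℝ} (hσ : 0 < σ) (hb : 0 ≤ b) (t k : ℕ) :
    0 ≤ noiseWeight σ K b t k := by
  unfold noiseWeight; split_ifs <;> positivity

/-- The constant in `noiseWeight` is chosen so that the compensator is at most the surplus `3 s
‖Δ‖²` of the descent inequality under the same weight. The denominator `t + b` is needed because the
compensator grows like `s²`, but the surplus only like `s`. -/
theorem noiseWeight_sq_le {K b D : ℝ} (hσ : 0 < σ) (hb : 0 ≤ b) (hK : 0 < K) {t k : ℕ}
    (hk : 1 ≤ k) (hkt : k ≤ t) :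
    (noiseWeight σ K b t k * (2 * K * D)) ^ 2 / 2
      ≤ 3 * σ ^ 2 / (512 * K ^ 2 * (t + b)) * (3 * (k + b) * D ^ 2) := by
  have hk0 : (1 : ℝ) ≤ k := by exact_mod_cast hk
  have hkt' : (k : ℝ) ≤ t := by exact_mod_cast hkt
  have hs : 1 ≤ k + b := by linarith
  have hst : k + b ≤ t + b := by linarith
  rw [noiseWeight, if_neg (by omega)]
  set s := (k : ℝ) + b
  set s' := (t : ℝ) + b
  have hs0 : 0 < s := by linarith
  have hs'0 : 0 < s' := by linarith
  have hq : 4 / σ * ((s + 1) ^ 2 / s) ≤ 16 / σ * s := by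
    have : (s + 1) ^ 2 / s ≤ 4 * s := by rw [div_le_iff₀ hs0]; nlinarith
    calc 4 / σ * ((s + 1) ^ 2 / s) ≤ 4 / σ * (4 * s) := by gcongr
      _ = _ := by ring
  set θ := 3 * σ ^ 2 / (512 * K ^ 2 * s') with hθ
  have hθ0 : 0 ≤ θ := by positivity
  have hq0 : 0 ≤ 4 / σ * ((s + 1) ^ 2 / s) := by positivity
  calc (θ * (4 / σ * ((s + 1) ^ 2 / s)) * (2 * K * D)) ^ 2 / 2
      = θ * (θ * (2 * K ^ 2 * D ^ 2 * (4 / σ * ((s + 1) ^ 2 / s)) ^ 2)) := by ring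
    _ ≤ θ * (θ * (2 * K ^ 2 * D ^ 2 * (16 / σ * s) ^ 2)) := by gcongr
    _ = θ * (3 * (s / s') * s * D ^ 2) := by
        rw [hθ]; field_simp; ring
    _ ≤ θ * (3 * 1 * s * D ^ 2) := by
        gcongr
        exact (div_le_one hs'0).2 hst
    _ = _ := by ring

/-- The weighted descent inequalities telescope from index 1, where the iterate is 0. The four terms
on the right come from the starting point, the noise, the bias and the squared gradients. -/
theorem norm_proxIterate_sub_sq_le (hρ : ∀ᵐ z ∂ρ, z ∈ goodSet d κ) (hκ : 0 < κ)
    (h0 : 0 < posProb ρ) (h1 : posProb ρ < 1) (hlam : 0 < lam) {ws : Vec d}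
    (hws : ws ∈ minimizers (objective ρ (l2Reg lam))) (hσ : 0 < σ)
    (hgrow : QuadraticGrowth (objective ρ (l2Reg lam)) σ) {η : ℕ → ℝ} (hη : ∀ k, 0 ≤ η k)
    (hη0 : η 0 = 0) {y : ℕ → Sample d} (hy : ∀ i, y i ∈ goodSet d κ)
    (hR : ∀ k, ‖proxIterate η lam y k‖ ≤ R)
    {b B L K : ℝ} (hb : 0 ≤ b) (hB : 0 ≤ B)
    (hstep : ∀ k : ℕ, 1 ≤ k → η k / (1 + η k * lam) = 2 / (σ * (k + b)))
    (hK : K = 24 * R * κ ^ 2 + 4 * κ) {t : ℕ}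
    (hbias : ∀ k : ℕ, 1 ≤ k → k ≤ t → ‖meanGrad ρ y k (proxIterate η lam y k)
      - riskGrad ρ (proxIterate η lam y k)‖ ^ 2 ≤ B / k)
    (hnoise : ∑ k ∈ Finset.range (t + 1), (noiseWeight σ K b t k *
      inner ℝ (proxIterate η lam y k - ws) (meanGrad ρ y k (proxIterate η lam y k)
        - sampleGrad y k (proxIterate η lam y k) (y k))
      - (noiseWeight σ K b t k * (2 * K * ‖proxIterate η lam y k - ws‖)) ^ 2 / 2) ≤ L) :
    (t + 1 + b) ^ 2 * ‖proxIterate η lam y (t + 1) - ws‖ ^ 2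
      ≤ (1 + b) ^ 2 * ‖ws‖ ^ 2 + L * (512 * K ^ 2 / (3 * σ ^ 2)) * (t + b)
        + 8 / σ ^ 2 * B * (t + b * (1 + Real.log t)) + 16 / σ ^ 2 * (K + lam * R) ^ 2 * t := by
  have hR0 : 0 ≤ R := (norm_nonneg _).trans (hR 0)
  have hK0 : 0 < K := by rw [hK]; positivity
  have hw1 : proxIterate η lam y 1 = 0 := by simp [proxIterate, hη0]
  -- For `t = 0` the only noise term has weight zero, so the noise hypothesis says `0 ≤ L`.
  rcases Nat.eq_zero_or_pos t with rfl | ht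
  · simp only [zero_add, Finset.sum_range_one] at hnoise
    simp only [noiseWeight, if_true, zero_mul] at hnoise
    have hL : 0 ≤ L := by simpa using hnoise
    simp only [zero_add, hw1, zero_sub, norm_neg, Nat.cast_zero, Real.log_zero, mul_zero, add_zero]
    have : 0 ≤ L * (512 * K ^ 2 / (3 * σ ^ 2)) * b + 8 / σ ^ 2 * B * (b * 1) := by positivity
    linarith
  have ht0 : (0 : ℝ) < t := by exact_mod_cast ht
  set D := fun k : ℕ => ‖proxIterate η lam y k - ws‖ with hD
  set I := fun k : ℕ => (inner ℝ (proxIterate η lam y k - ws)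
    (meanGrad ρ y k (proxIterate η lam y k)
      - sampleGrad y k (proxIterate η lam y k) (y k)) : ℝ) with hI
  set θ := 3 * σ ^ 2 / (512 * K ^ 2 * (t + b)) with hθ
  have hθ0 : 0 < θ := by positivity
  set s := fun k : ℕ => (k : ℝ) + b with hs
  have hs1 : ∀ k : ℕ, 1 ≤ s (k + 1) := fun k => by
    simp only [hs]; push_cast; have := Nat.cast_nonneg (α := ℝ) k; linarith
  set M := fun k : ℕ => 4 / σ * ((s k + 1) ^ 2 / s k) * I k with hM
  have hsum := le_of_descent (E := fun k => s k ^ 2 * D k ^ 2)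
    (r := fun k => (M (k + 1) - 3 * s (k + 1) * D (k + 1) ^ 2)
      + 8 / σ ^ 2 * B * (1 + b * (1 / (k + 1))) + 16 / σ ^ 2 * (K + lam * R) ^ 2) t (by
    intro k hk
    have hk1 : (0 : ℝ) < (k : ℝ) + 1 := by positivity
    have := descent_proxIterate hρ hκ.le h0 h1 hlam hws hσ hgrow hη hy (hR (k + 1)) (hs1 k)
      (by rw [hstep (k + 1) (by omega)]) (hbias (k + 1) (by omega) (by omega))
    rw [← hK] at this
    have e1 : s (k + 1) * (B / ((k + 1 : ℕ) : ℝ)) = B * (1 + b * (1 / (k + 1))) := by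
      simp only [hs]; push_cast; field_simp
    have e2 : s (k + 1) + 1 = s (k + 2) := by simp only [hs]; push_cast; ring
    rw [e1] at this
    simp only [hM, hD, hI]
    rw [← e2]
    linarith)
  -- The surplus dominates the compensator term by term, so `θ` times the sum is at most the
  -- compensated noise, hence at most `L`. Dividing by `θ` produces the factor `t + b`.
  have hN : ∑ k ∈ Finset.range t, (M (k + 1) - 3 * s (k + 1) * D (k + 1) ^ 2)
      ≤ L * (512 * K ^ 2 / (3 * σ ^ 2)) * (t + b) := by
    have hle : θ * ∑ k ∈ Finset.range t, (M (k + 1) - 3 * s (k + 1) * D (k + 1) ^ 2) ≤ L := by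
      refine le_trans ?_ hnoise
      rw [Finset.sum_range_succ', Finset.mul_sum]
      have hz : noiseWeight σ K b t 0 = 0 := by simp [noiseWeight]
      rw [hz]
      simp only [zero_mul, ne_eq, OfNat.ofNat_ne_zero, not_false_eq_true, zero_pow, zero_div,
        sub_zero, add_zero]
      refine Finset.sum_le_sum fun k hk => ?_
      have hq := noiseWeight_sq_le (D := D (k + 1)) hσ hb hK0 (Nat.succ_le_succ (Nat.zero_le k))
        (Finset.mem_range.1 hk)
      have e : noiseWeight σ K b t (k + 1) * I (k + 1) = θ * M (k + 1) := by
        simp only [noiseWeight, hM, hs, hθ]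
        rw [if_neg (by omega)]
        ring
      simp only [hI, hD] at e hq ⊢
      rw [e]
      simp only [hs, ← hθ] at hq ⊢
      linarith
    have hL : L * (512 * K ^ 2 / (3 * σ ^ 2)) * (t + b) = L / θ := by
      rw [hθ]; field_simp
    rw [hL, le_div_iff₀ hθ0]
    linarith
  have hlog := sum_inv_le_one_add_log t
  rw [Finset.sum_add_distrib, Finset.sum_add_distrib, ← Finset.mul_sum, Finset.sum_add_distrib,
    ← Finset.mul_sum] at hsum
  simp only [Finset.sum_const, Finset.card_range, nsmul_eq_mul, mul_one, hD, hs, hw1, zero_sub,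
    norm_neg, Nat.cast_add, Nat.cast_one] at hsum hN
  have hfin : 8 / σ ^ 2 * B * (t + b * ∑ k ∈ Finset.range t, 1 / ((k : ℝ) + 1))
      ≤ 8 / σ ^ 2 * B * (t + b * (1 + Real.log t)) := by gcongr
  linarith

end Summation

/-! ### Rates -/

section Rates

theorem sum_Icc_one_eq_sum_range {M : Type*} [AddCommMonoid M] (f : ℕ → M) (t : ℕ) :
    ∑ k ∈ Finset.Icc 1 t, f k = ∑ k ∈ Finset.range t, f (k + 1) := by
  rw [Finset.range_eq_Ico, Finset.sum_Ico_add' f 0 t 1]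
  rfl

/-- The bound on the iterates in terms of the quantities of the descent inequality. -/
theorem rate_of_sq_mul_le {a t₁ τ ℓ ω t L cL c₁ c₂ c₃ x : ℝ} (ha : 0 ≤ a) (hτ : 0 < τ)
    (hτt : τ ≤ t₁) (ht : 0 ≤ t) (hℓ : 1 ≤ ℓ) (hlog : 1 + Real.log t ≤ 2 * ℓ) (hL0 : 0 ≤ L)
    (hL : L ≤ cL * ℓ)
    (hω : 0 ≤ ω) (h1 : 0 ≤ c₁) (h2 : 0 ≤ c₂) (h3 : 0 ≤ c₃) (hcL : 0 ≤ cL)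
    (hx : (t + 1 + (t₁ + a)) ^ 2 * x ≤ (1 + (t₁ + a)) ^ 2 * ω + L * c₁ * (t + (t₁ + a))
      + c₂ * L * (t + (t₁ + a) * (1 + Real.log t)) + c₃ * t) :
    x ≤ ((1 + (1 + a) / τ) ^ 2 * ω + (cL * c₁ + 2 * c₂ * cL + c₃) / τ) * t₁ * ℓ ^ 2 / (t + 1) := by
  have ht₁ : 0 < t₁ := hτ.trans_le hτt
  set s := t + 1 + (t₁ + a) with hs
  have hs0 : 0 < s := by positivity
  have hℓ2 : ℓ ≤ ℓ ^ 2 := by nlinarith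
  have b0 : 1 + (t₁ + a) ≤ (1 + (1 + a) / τ) * t₁ := by
    have : 1 + a ≤ (1 + a) / τ * t₁ := by
      rw [div_mul_eq_mul_div, le_div_iff₀ hτ]; gcongr
    linarith
  have b1 : (1 + (t₁ + a)) ^ 2 * ω ≤ (1 + (1 + a) / τ) ^ 2 * ω * t₁ ^ 2 := by
    calc (1 + (t₁ + a)) ^ 2 * ω ≤ ((1 + (1 + a) / τ) * t₁) ^ 2 * ω := by gcongr
      _ = _ := by ring
  have b2 : L * c₁ * (t + (t₁ + a)) ≤ cL * c₁ * ℓ ^ 2 * s := by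
    calc L * c₁ * (t + (t₁ + a)) ≤ cL * ℓ * c₁ * s := by gcongr; linarith
      _ ≤ cL * ℓ ^ 2 * c₁ * s := by gcongr
      _ = _ := by ring
  have b3 : c₂ * L * (t + (t₁ + a) * (1 + Real.log t)) ≤ 2 * c₂ * cL * ℓ ^ 2 * s := by
    have hin : t + (t₁ + a) * (1 + Real.log t) ≤ 2 * ℓ * s := by
      calc t + (t₁ + a) * (1 + Real.log t) ≤ t * (2 * ℓ) + (t₁ + a) * (2 * ℓ) := by
            gcongr
            nlinarith
        _ = 2 * ℓ * (t + (t₁ + a)) := by ring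
        _ ≤ _ := by gcongr; linarith
    calc c₂ * L * (t + (t₁ + a) * (1 + Real.log t)) ≤ c₂ * L * (2 * ℓ * s) := by gcongr
      _ ≤ c₂ * (cL * ℓ) * (2 * ℓ * s) := by gcongr
      _ = _ := by ring
  have b4 : c₃ * t ≤ c₃ * ℓ ^ 2 * s := by
    calc c₃ * t ≤ c₃ * (1 * s) := by gcongr; linarith
      _ ≤ c₃ * (ℓ ^ 2 * s) := by gcongr; nlinarith
      _ = _ := by ring
  set c₇ := cL * c₁ + 2 * c₂ * cL + c₃ with hc₇
  have hc₇0 : 0 ≤ c₇ := by positivity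
  set c₉ := (1 + (1 + a) / τ) ^ 2 * ω with hc₉
  have hc₉0 : 0 ≤ c₉ := by positivity
  have hx' : s ^ 2 * x ≤ c₉ * t₁ ^ 2 + c₇ * ℓ ^ 2 * s := by
    rw [hc₇]; linarith
  have ht1 : 0 < t + 1 := by linarith
  rw [le_div_iff₀ ht1]
  -- The starting term uses `t₁ (t + 1) ≤ s²`; the others lack a factor `t₁`, which is supplied by
  -- `1 ≤ t₁ / τ`.
  have hkey : s ^ 2 * (x * (t + 1)) ≤ s ^ 2 * ((c₉ + c₇ / τ) * t₁ * ℓ ^ 2) := by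
    have k1 : t₁ * (t + 1) ≤ s ^ 2 := by
      rw [sq]; exact mul_le_mul (by linarith) (by linarith) ht1.le hs0.le
    have k2 : 1 ≤ t₁ / τ := (one_le_div hτ).2 hτt
    calc s ^ 2 * (x * (t + 1)) = s ^ 2 * x * (t + 1) := by ring
      _ ≤ (c₉ * t₁ ^ 2 + c₇ * ℓ ^ 2 * s) * (t + 1) := by gcongr
      _ = c₉ * t₁ * (t₁ * (t + 1)) * 1 + c₇ * ℓ ^ 2 * s * (t + 1) * 1 := by ring
      _ ≤ c₉ * t₁ * s ^ 2 * ℓ ^ 2 + c₇ * ℓ ^ 2 * s * s * (t₁ / τ) := by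
          gcongr
          · nlinarith
          · linarith
      _ = _ := by field_simp
  exact le_of_mul_le_mul_left hkey (by positivity)

variable {d : ℕ} {t₁ : ℝ}

theorem sum_weights_ge (ht₁ : 0 ≤ t₁) (t : ℕ) :
    t * (t + t₁ + 1) / 2 ≤ ∑ k ∈ Finset.Icc 1 t, ((k : ℝ) + t₁ + 1) := by
  rw [sum_Icc_one_eq_sum_range]
  induction t with
  | zero => simp
  | succ t ih =>
    rw [Finset.sum_range_succ]
    push_cast at ih ⊢
    linarith

/-- Cauchy–Schwarz with the averaging weights reduces this to `∑ (k + t₁ + 1) / k`, which is at most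
`2 ℓ (t + t₁ + 1)`, while the total weight is at least `t (t + t₁ + 1) / 2`. -/
theorem norm_weightedAvg_sub_sq_le (ht₁ : 0 ≤ t₁) (w : ℕ → Vec d) (ws : Vec d) {t : ℕ}
    (ht : 1 ≤ t) {A ℓ : ℝ} (hA : 0 ≤ A) (hℓ : 1 + Real.log t ≤ 2 * ℓ) (hℓ1 : 1 ≤ ℓ)
    (h : ∀ k, 1 ≤ k → k ≤ t → ‖w k - ws‖ ^ 2 ≤ A / k) :
    ‖weightedAvg t₁ w t - ws‖ ^ 2 ≤ 4 * A * ℓ / t := by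
  set W := ∑ k ∈ Finset.Icc 1 t, ((k : ℝ) + t₁ + 1) with hW
  have ht0 : (0 : ℝ) < t := by exact_mod_cast ht
  have hWge := sum_weights_ge ht₁ t
  have hW0 : 0 < W := lt_of_lt_of_le (by positivity) hWge
  have e : weightedAvg t₁ w t - ws
      = W⁻¹ • ∑ k ∈ Finset.Icc 1 t, ((k : ℝ) + t₁ + 1) • (w k - ws) := by
    simp only [smul_sub, Finset.sum_sub_distrib]
    rw [← Finset.sum_smul, ← hW, smul_smul, inv_mul_cancel₀ hW0.ne', one_smul, weightedAvg]
  have hn : ‖∑ k ∈ Finset.Icc 1 t, ((k : ℝ) + t₁ + 1) • (w k - ws)‖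
      ≤ ∑ k ∈ Finset.Icc 1 t, ((k : ℝ) + t₁ + 1) * ‖w k - ws‖ := by
    refine norm_sum_le_of_le _ fun k _ => ?_
    rw [norm_smul, Real.norm_eq_abs, abs_of_nonneg (by positivity)]
  have hcs : (∑ k ∈ Finset.Icc 1 t, ((k : ℝ) + t₁ + 1) * ‖w k - ws‖) ^ 2
      ≤ W * ∑ k ∈ Finset.Icc 1 t, ((k : ℝ) + t₁ + 1) * ‖w k - ws‖ ^ 2 :=
    Finset.sum_sq_le_sum_mul_sum_of_sq_le_mul _ (fun k _ => by positivity)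
      (fun k _ => by positivity) fun k _ => le_of_eq (by ring)
  have hsum : ∑ k ∈ Finset.Icc 1 t, ((k : ℝ) + t₁ + 1) * ‖w k - ws‖ ^ 2
      ≤ A * (2 * ℓ * (t + t₁ + 1)) := by
    calc _ ≤ ∑ k ∈ Finset.Icc 1 t, ((k : ℝ) + t₁ + 1) * (A / k) := by
          refine Finset.sum_le_sum fun k hk => ?_
          rw [Finset.mem_Icc] at hk
          gcongr
          exact h k hk.1 hk.2
      _ = A * (t + (t₁ + 1) * ∑ k ∈ Finset.range t, 1 / ((k : ℝ) + 1)) := by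
          rw [sum_Icc_one_eq_sum_range, mul_add, Finset.mul_sum, Finset.mul_sum,
            ← nsmul_one t, ← Finset.card_range t, ← Finset.sum_const, Finset.card_range,
            Finset.mul_sum, ← Finset.sum_add_distrib]
          refine Finset.sum_congr rfl fun k _ => ?_
          have : (k : ℝ) + 1 ≠ 0 := by positivity
          push_cast
          field_simp
          ring
      _ ≤ A * (t * (2 * ℓ) + (t₁ + 1) * (2 * ℓ)) := by
          gcongr
          · nlinarith
          · exact (sum_inv_le_one_add_log t).trans hℓ
      _ = _ := by ring
  rw [e, norm_smul, mul_pow, norm_inv, Real.norm_eq_abs, abs_of_pos hW0]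
  calc W⁻¹ ^ 2 * ‖∑ k ∈ Finset.Icc 1 t, ((k : ℝ) + t₁ + 1) • (w k - ws)‖ ^ 2
      ≤ W⁻¹ ^ 2 * (W * (A * (2 * ℓ * (t + t₁ + 1)))) := by
        gcongr
        refine le_trans (by gcongr) (hcs.trans (by gcongr))
    _ = A * (2 * ℓ * (t + t₁ + 1)) / W := by field_simp
    _ ≤ A * (2 * ℓ * (t + t₁ + 1)) / (t * (t + t₁ + 1) / 2) := by gcongr
    _ = _ := by field_simp; ring

end Rates

/-! ### The event on which all bounds hold -/

section Event

variable {S : Type*} [MeasurableSpace S] {d : ℕ} {κ lam R σ : ℝ} {ρ : Measure (Sample d)}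
  {P : Measure S} {z : ℕ → S → Sample d}

/-- The label that belongs to a Boolean value. -/
def boolLabel (b : Bool) : ℤ := if b then 1 else -1

/-- The noise weights depend on the horizon `t`, so each `t` needs its own event. It costs one
exponential bound for the noise and two for each of the `2 (d + 1)` test functions, hence `4 d + 5`
in all. -/
theorem exists_exceptional_set [IsProbabilityMeasure ρ] [IsProbabilityMeasure P]
    (hρ : ∀ᵐ z ∂ρ, z ∈ goodSet d κ) (hκ : 1 ≤ κ) (hlam : 0 < lam)
    (hz : ∀ t, Measurable (z t)) (hzρ : ∀ t, P.map (z t) = ρ) (hind : iIndepFun z P)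
    {η : ℕ → ℝ} (hη : ∀ k, 0 ≤ η k) (hηκ : ∀ k, η k * (16 * κ ^ 2) ≤ 1)
    (hR : 1 / (4 * lam) ≤ R ^ 2) (hR0 : 0 ≤ R) (ws : Vec d) (hσ : 0 < σ) {b K L : ℝ}
    (hb : 0 ≤ b) (hK : K = 24 * R * κ ^ 2 + 4 * κ) (hL : 0 < L) (T : ℕ) :
    ∃ N : Set S, P N ≤ ENNReal.ofReal (T * ((4 * d + 5) * Real.exp (-L))) ∧ ∀ s ∉ N,
      (∀ i, z i s ∈ goodSet d κ) ∧ ∀ t < T,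
        (∑ k ∈ Finset.range (t + 1), (noiseWeight σ K b t k *
          inner ℝ (proxIterate η lam (fun i => z i s) k - ws)
            (meanGrad ρ (fun i => z i s) k (proxIterate η lam (fun i => z i s) k)
              - sampleGrad (fun i => z i s) k (proxIterate η lam (fun i => z i s) k) (z k s))
          - (noiseWeight σ K b t k *
            (2 * K * ‖proxIterate η lam (fun i => z i s) k - ws‖)) ^ 2 / 2) ≤ L) ∧
        ∀ (c : Bool) (o : Option (Fin d)),
          |(∑ k ∈ Finset.range (t + 1), testFun (boolLabel c) o (z k s)) / ((t + 1 : ℕ) : ℝ)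
            - ∫ x, testFun (boolLabel c) o x ∂ρ| ≤ 3 * κ * √(L / ((t + 1 : ℕ) : ℝ)) := by
  have hκ0 : 0 ≤ κ := by linarith
  have hKm := measurableSet_goodSet (d := d) κ
  have hne : (goodSet d κ).Nonempty := ⟨(0, 1), by simpa using hκ0, Or.inl rfl⟩
  set e := ENNReal.ofReal (Real.exp (-L)) with he
  set N₀ : Set S := {s | ¬ ∀ i, z i s ∈ goodSet d κ} with hN₀
  have hN₀0 : P N₀ = 0 := by
    have : ∀ᵐ s ∂P, ∀ i, z i s ∈ goodSet d κ := by
      rw [ae_all_iff]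
      intro i
      rw [← hzρ i] at hρ
      exact (ae_map_iff (hz i).aemeasurable hKm).1 hρ
    exact this
  set N₁ : ℕ → Set S := fun t => {s | L ≤ ∑ k ∈ Finset.range (t + 1), (noiseWeight σ K b t k *
          inner ℝ (proxIterate η lam (fun i => z i s) k - ws)
            (meanGrad ρ (fun i => z i s) k (proxIterate η lam (fun i => z i s) k)
              - sampleGrad (fun i => z i s) k (proxIterate η lam (fun i => z i s) k) (z k s))
          - (noiseWeight σ K b t k *
            (2 * K * ‖proxIterate η lam (fun i => z i s) k - ws‖)) ^ 2 / 2)} with hN₁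
  have hN₁e : ∀ t, P (N₁ t) ≤ e := by
    intro t
    have := (isIncrement_noise hρ hκ0 hlam hη hηκ hR hR0 ws
      (noiseWeight_nonneg (K := K) hσ hb t)).measure_sum_ge_le hKm hne hρ hz hzρ hind (t + 1) L
    rw [← hK] at this
    exact this
  set N₂ : ℕ → Bool × Option (Fin d) → Set S := fun t q =>
    {s | 3 * κ * √(L / ((t + 1 : ℕ) : ℝ))
      < |(∑ k ∈ Finset.range (t + 1), testFun (boolLabel q.1) q.2 (z k s)) / ((t + 1 : ℕ) : ℝ)
            - ∫ x, testFun (boolLabel q.1) q.2 x ∂ρ|} with hN₂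
  have hN₂e : ∀ t q, P (N₂ t q) ≤ 2 * e := fun t q =>
    measure_abs_mean_sub_gt_le hKm hne hρ hz hzρ hind (measurable_testFun _ _)
      (by linarith) (fun x hx => abs_testFun_le hκ _ _ hx) (Nat.succ_le_succ (Nat.zero_le t)) hL
  refine ⟨N₀ ∪ ⋃ t ∈ Finset.range T, (N₁ t ∪ ⋃ q, N₂ t q), ?_, ?_⟩
  · have h1 : ∀ t, P (N₁ t ∪ ⋃ q, N₂ t q) ≤ ENNReal.ofReal ((4 * d + 5) * Real.exp (-L)) := by
      intro t
      refine (measure_union_le _ _).trans ((add_le_add (hN₁e t)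
        ((measure_iUnion_fintype_le _ _).trans (Finset.sum_le_sum fun q _ => hN₂e t q))).trans ?_)
      rw [ENNReal.ofReal_mul (by positivity), ← he]
      simp only [Finset.sum_const, Finset.card_univ, Fintype.card_prod, Fintype.card_bool,
        Fintype.card_option, Fintype.card_fin, nsmul_eq_mul]
      have h45 : ENNReal.ofReal (4 * (d : ℝ) + 5) = 4 * d + 5 := by
        have : (4 * (d : ℝ) + 5) = ((4 * d + 5 : ℕ) : ℝ) := by push_cast; ring
        rw [this, ENNReal.ofReal_natCast]
        push_cast
        ring
      rw [h45]
      push_cast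
      refine le_of_eq ?_
      ring
    refine (measure_union_le _ _).trans ?_
    rw [hN₀0, zero_add]
    refine (measure_biUnion_finset_le _ _).trans ((Finset.sum_le_sum fun t _ => h1 t).trans ?_)
    rw [ENNReal.ofReal_mul (Nat.cast_nonneg T), ENNReal.ofReal_natCast, Finset.sum_const,
      Finset.card_range, nsmul_eq_mul]
  · intro s hs
    simp only [Set.mem_union, Set.mem_iUnion, Finset.mem_range, not_or, not_exists] at hs
    refine ⟨by simpa [hN₀] using hs.1, fun t ht => ⟨?_, fun c o => ?_⟩⟩
    · have := (hs.2 t ht).1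
      simp only [hN₁, Set.mem_ofPred_eq, not_le] at this
      exact this.le
    · have := (hs.2 t ht).2 (c, o)
      simpa only [hN₂, Set.mem_ofPred_eq, not_lt] using this

end Event

/-! ### Fast rates for stochastic proximal AUC maximization -/

section FastRates

variable {d : ℕ} {κ lam σφ σΩ : ℝ} {ρ : Measure (Sample d)}

theorem norm_le_kappa {X : Set (Vec d)} (hX : Bornology.IsBounded X) {x : Vec d} (hx : x ∈ X) :
    ‖x‖ ≤ kappa X := by
  obtain ⟨C, hC⟩ := hX.exists_norm_le
  have hb : BddAbove (Set.range fun x : X => ‖(x : Vec d)‖) :=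
    ⟨C, by rintro _ ⟨x, rfl⟩; exact hC x x.2⟩
  exact (le_ciSup hb ⟨x, hx⟩).trans (le_max_right _ _)

theorem ofReal_one_sub_le_of_compl_subset {S : Type*} [MeasurableSpace S] {P : Measure S}
    [IsProbabilityMeasure P] {N A : Set S} {δ : ℝ} (hδ : 0 ≤ δ) (hN : P N ≤ ENNReal.ofReal δ)
    (h : ∀ s ∉ N, s ∈ A) : ENNReal.ofReal (1 - δ) ≤ P A := by
  rw [ENNReal.ofReal_sub _ hδ, ENNReal.ofReal_one, tsub_le_iff_right]
  calc 1 = P Set.univ := measure_univ.symm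
    _ ≤ P (A ∪ N) := measure_mono fun s _ => by
        by_cases hs : s ∈ N
        · exact Or.inr hs
        · exact Or.inl (h s hs)
    _ ≤ P A + P N := measure_union_le _ _
    _ ≤ _ := by gcongr

/-- The constant in the bound for the squared bias. -/
def biasConst (ρ : Measure (Sample d)) (κ K : ℝ) : ℝ :=
  (K * (1 + (κ + d) / posProb ρ + (κ + d) / (1 - posProb ρ)) * (3 * κ)) ^ 2

/-- The constant in the bound for the iterates. -/
def iterateConst (ρ : Measure (Sample d)) (κ K a lam R σ : ℝ) (ws : Vec d) : ℝ :=
  (1 + (1 + a) / (512 / σ)) ^ 2 * ‖ws‖ ^ 2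
    + ((1 + Real.log (4 * d + 5)) * (512 * K ^ 2 / (3 * σ ^ 2))
      + 2 * (8 / σ ^ 2 * biasConst ρ κ K) * (1 + Real.log (4 * d + 5))
      + 16 / σ ^ 2 * (K + lam * R) ^ 2) / (512 / σ)

theorem iterateConst_nonneg {K a R σ : ℝ} (hσ : 0 < σ) (ws : Vec d) :
    0 ≤ iterateConst ρ κ K a lam R σ ws := by
  have hlog : 0 ≤ Real.log (4 * d + 5) := Real.log_nonneg (by
    have := Nat.cast_nonneg (α := ℝ) d; linarith)
  unfold iterateConst biasConst
  positivity

variable [IsProbabilityMeasure ρ]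

theorem norm_bias_sq_le (hρ : ∀ᵐ z ∂ρ, z ∈ goodSet d κ) (hκ : 1 ≤ κ)
    (h0 : 0 < posProb ρ) (h1 : posProb ρ < 1) {y : ℕ → Sample d}
    (hy : ∀ i, y i ∈ goodSet d κ) {k : ℕ} {w : Vec d} {R K L : ℝ} (hw : ‖w‖ ≤ R)
    (hK : K = 24 * R * κ ^ 2 + 4 * κ) (hL : 0 ≤ L)
    (h : ∀ (c : Bool) (o : Option (Fin d)),
      |(∑ i ∈ Finset.range k, testFun (boolLabel c) o (y i)) / (k : ℝ)
        - ∫ x, testFun (boolLabel c) o x ∂ρ| ≤ 3 * κ * √(L / k)) :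
    ‖meanGrad ρ y k w - riskGrad ρ w‖ ^ 2 ≤ biasConst ρ κ K * L / k := by
  have hκ0 : 0 ≤ κ := by linarith
  have hR : 0 ≤ R := (norm_nonneg _).trans hw
  have hK0 : 0 ≤ K := by rw [hK]; positivity
  have hp := classProb_one (ρ := ρ)
  have hn := classProb_neg_one hρ
  set r := 3 * κ * √(L / k) with hr
  have a := abs_empProb_sub_le (h true none)
  have b := norm_empMean_sub_le hρ hκ0 hy (l := 1) (by rwa [hp]) (h true)
  have c := norm_empMean_sub_le hρ hκ0 hy (l := -1) (by rw [hn]; linarith) (h false)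
  rw [hp] at b
  rw [hn] at c
  have e := norm_meanGrad_sub_riskGrad_le hρ hκ h0 h1 hy k hw
  rw [← hK] at e
  have f : ‖meanGrad ρ y k w - riskGrad ρ w‖
      ≤ K * (1 + (κ + d) / posProb ρ + (κ + d) / (1 - posProb ρ)) * (3 * κ) * √(L / k) := by
    refine e.trans ?_
    calc _ ≤ K * (r + (κ + d) / posProb ρ * r + (κ + d) / (1 - posProb ρ) * r) := by gcongr
      _ = _ := by rw [hr]; ring
  calc _ ≤ (K * (1 + (κ + d) / posProb ρ + (κ + d) / (1 - posProb ρ)) * (3 * κ)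
        * √(L / k)) ^ 2 := by gcongr
    _ = _ := by
      rw [mul_pow, Real.sq_sqrt (by positivity), biasConst, mul_div_assoc]

theorem exists_fast_rate (hρ : ∀ᵐ z ∂ρ, z ∈ goodSet d κ) (hκ : 1 ≤ κ) (h0 : 0 < posProb ρ)
    (h1 : posProb ρ < 1) (hlam : 0 < lam) (hσ : 0 < σφ)
    (hgrow : QuadraticGrowth (objective ρ (l2Reg lam)) σφ) (hΩ : σΩ ≤ σφ) :
    ∃ C : ℝ, 0 < C ∧ ∀ (δ : ℝ) (T : ℕ) (t₁ : ℝ), 0 < δ → δ < 1 → 2 < T →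
      512 * κ ^ 2 / σφ * Real.log (2 * T / δ) ≤ t₁ →
      ∀ (S : Type*) (_ : MeasurableSpace S) (P : Measure S)
        (z : ℕ → S → Sample d) (w : ℕ → S → Vec d), IsProbabilityMeasure P →
        (∀ t, Measurable (z t)) → (∀ t, P.map (z t) = ρ) → iIndepFun z P →
        (∀ s, IsSPAUC (stepSize σφ σΩ t₁) (l2Reg lam) (fun t => z t s) (fun t => w t s)) →
        ENNReal.ofReal (1 - δ) ≤ P {s | ∀ t : ℕ, 1 ≤ t → t ≤ T →
          (∃ ws, IsProjection (minimizers (objective ρ (l2Reg lam))) (w t s) ws ∧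
            ‖w t s - ws‖ ^ 2 ≤ C * t₁ * Real.log (T / δ) ^ 3 / t) ∧
          objective ρ (l2Reg lam) (weightedAvg t₁ (fun k => w k s) t)
              - (⨅ v, objective ρ (l2Reg lam) v)
            ≤ C * t₁ ^ 2 * Real.log (T / δ) ^ 3 / t} := by
  obtain ⟨ws, hws⟩ := exists_mem_minimizers hρ h0 h1 hlam
  set R := √(1 / (4 * lam)) with hRdef
  have hR0 : 0 ≤ R := Real.sqrt_nonneg _
  have hR : 1 / (4 * lam) ≤ R ^ 2 := by rw [hRdef, Real.sq_sqrt (by positivity)]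
  set K := 24 * R * κ ^ 2 + 4 * κ with hK
  -- The shift for which `σφ (k + t₁ + a)` is the denominator of the step size plus `2 lam`, as the
  -- reduction of the proximal step requires.
  set a := (2 * (σφ - σΩ) + 2 * lam) / σφ with ha
  have ha0 : 0 ≤ a := div_nonneg (by linarith) hσ.le
  set τ := 512 / σφ with hτ
  have hτ0 : 0 < τ := by positivity
  set C₀ := iterateConst ρ κ K a lam R σφ ws with hC₀
  have hC₀0 : 0 ≤ C₀ := iterateConst_nonneg hσ ws
  set Λ := 3 * κ ^ 2 + lam / 2 with hΛ
  have hΛ0 : 0 ≤ Λ := by positivity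
  -- `C₀` serves the iterates, `Λ * (4 * C₀) / τ` the averages, and 1 makes the constant positive.
  refine ⟨C₀ + Λ * (4 * C₀) / τ + 1, by positivity, ?_⟩
  intro δ T t₁ hδ hδ1 hT ht₁ S _ P z w hP hz hzρ hind hw
  have hT3 : (3 : ℝ) ≤ T := by exact_mod_cast hT
  have hexp : Real.exp 1 ≤ 3 := Real.exp_one_lt_three.le
  have hTδ : (T : ℝ) ≤ T / δ := by rw [le_div_iff₀ hδ]; nlinarith
  set ℓ := Real.log (T / δ) with hℓ
  have hℓ1 : 1 ≤ ℓ := (Real.le_log_iff_exp_le (by positivity)).2 (by linarith)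
  have hlogT : Real.log T ≤ ℓ := Real.log_le_log (by linarith) hTδ
  have hlog : ∀ t : ℕ, t ≤ T → 1 + Real.log t ≤ 2 * ℓ := by
    intro t ht
    have : Real.log t ≤ Real.log T := by
      rcases Nat.eq_zero_or_pos t with rfl | h
      · simpa using Real.log_nonneg (by linarith)
      · exact Real.log_le_log (by exact_mod_cast h) (by exact_mod_cast ht)
    linarith
  have hℓ' : 1 ≤ Real.log (2 * T / δ) := by
    refine hℓ1.trans (Real.log_le_log (by positivity) ?_)
    gcongr
    linarith
  have hκ2 : 1 ≤ κ ^ 2 := one_le_pow₀ hκ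
  have hσt : 512 * κ ^ 2 ≤ σφ * t₁ := by
    have : 512 * κ ^ 2 / σφ * 1 ≤ t₁ := le_trans (by gcongr) ht₁
    rw [mul_one, div_le_iff₀ hσ] at this
    linarith
  have hτt : τ ≤ t₁ := by
    rw [hτ, div_le_iff₀ hσ]; linarith
  have ht₁0 : 0 < t₁ := hτ0.trans_le hτt
  have hlogd : 0 ≤ Real.log (4 * d + 5) := Real.log_nonneg (by
    have := Nat.cast_nonneg (α := ℝ) d; linarith)
  -- With this `L` the union bound over `T` horizons adds up to exactly `δ`.
  set L := Real.log (4 * d + 5) + ℓ with hL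
  have hL0 : 0 < L := by linarith
  have hLℓ : L ≤ (1 + Real.log (4 * d + 5)) * ℓ := by nlinarith
  have hprob : (T : ℝ) * ((4 * d + 5) * Real.exp (-L)) = δ := by
    rw [hL, neg_add, Real.exp_add, Real.exp_neg, Real.exp_neg, Real.exp_log (by positivity),
      hℓ, Real.exp_log (by positivity)]
    field_simp
  -- With step size zero at index 0, the recursion from `proxIterate 0 = 0` reproduces `w 1 = 0`,
  -- and `z 0` enters only through the class statistics.
  set η : ℕ → ℝ := fun k => if k = 0 then 0 else stepSize σφ σΩ t₁ k with hηdef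
  have hden : ∀ k : ℕ, 512 * κ ^ 2 ≤ σφ * k + 2 * (σφ - σΩ) + σφ * t₁ := fun k => by
    have : 0 ≤ σφ * k := by positivity
    linarith
  have hstep0 : ∀ k, 0 ≤ stepSize σφ σΩ t₁ k := fun k =>
    div_nonneg zero_le_two (by linarith [hden k])
  have hη : ∀ k, 0 ≤ η k := fun k => by
    simp only [hηdef]; split_ifs
    · exact le_rfl
    · exact hstep0 k
  have hηκ : ∀ k, η k * (16 * κ ^ 2) ≤ 1 := fun k => by
    simp only [hηdef]; split_ifs
    · norm_num
    · rw [stepSize, div_mul_eq_mul_div, div_le_one (by linarith [hden k])]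
      linarith [hden k]
  have hηstep : ∀ k : ℕ, 1 ≤ k → η k / (1 + η k * lam) = 2 / (σφ * (k + (t₁ + a))) := by
    intro k hk
    have hd : 0 < σφ * k + 2 * (σφ - σΩ) + σφ * t₁ := by linarith [hden k]
    have e : σφ * (k + (t₁ + a)) = σφ * k + 2 * (σφ - σΩ) + σφ * t₁ + 2 * lam := by
      rw [ha]; field_simp; ring
    rw [e]
    simp only [hηdef]
    rw [if_neg (by omega), stepSize]
    have : 0 < σφ * k + 2 * (σφ - σΩ) + σφ * t₁ + 2 * lam := by linarith
    have h3 : 1 + 2 / (σφ * k + 2 * (σφ - σΩ) + σφ * t₁) * lam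
        = (σφ * k + 2 * (σφ - σΩ) + σφ * t₁ + 2 * lam)
          / (σφ * k + 2 * (σφ - σΩ) + σφ * t₁) := by
      field_simp
    rw [h3, div_div_div_cancel_right₀ hd.ne']
  obtain ⟨N, hN, hgood⟩ := exists_exceptional_set hρ hκ hlam hz hzρ hind hη hηκ hR hR0 ws hσ
    (b := t₁ + a) (by positivity) hK hL0 T
  rw [hprob] at hN
  refine ofReal_one_sub_le_of_compl_subset hδ.le hN fun s hs => ?_
  obtain ⟨hy, hev⟩ := hgood s hs
  set y : ℕ → Sample d := fun i => z i s with hydef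
  have hRk := norm_proxIterate_le (R := R) (by linarith) hlam hη hηκ hR hR0 hy
  have hwk : ∀ t, 1 ≤ t → w t s = proxIterate η lam y t := fun t ht =>
    (hw s).eq_proxIterate (fun k _ => hstep0 k) (by simp [hηdef])
      (fun k hk => by simp only [hηdef]; rw [if_neg (by omega)]) hlam ht
  have hrate : ∀ n : ℕ, 1 ≤ n → n ≤ T → ‖w n s - ws‖ ^ 2 ≤ C₀ * t₁ * ℓ ^ 2 / n := by
    intro n hn hnT
    obtain ⟨t, rfl⟩ : ∃ t, n = t + 1 := ⟨n - 1, by omega⟩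
    rw [hwk _ hn]
    have hβ : 0 ≤ biasConst ρ κ K := sq_nonneg _
    have hmain := norm_proxIterate_sub_sq_le hρ (by linarith) h0 h1 hlam hws hσ hgrow hη
      (by simp [hηdef]) hy hRk (b := t₁ + a) (by positivity)
      (B := biasConst ρ κ K * L) (by positivity) hηstep hK (t := t) (fun k hk hkt => by
        obtain ⟨j, rfl⟩ : ∃ j, k = j + 1 := ⟨k - 1, by omega⟩
        exact norm_bias_sq_le hρ hκ h0 h1 hy (hRk _) hK hL0.le (hev j (by omega)).2)
      (hev t (by omega)).1
    rw [← mul_assoc (8 / σφ ^ 2)] at hmain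
    have := rate_of_sq_mul_le ha0 hτ0 hτt (Nat.cast_nonneg t) hℓ1 (hlog t (by omega)) hL0.le hLℓ
      (sq_nonneg ‖ws‖) (by positivity) (by positivity) (by positivity) (by positivity) hmain
    rw [Nat.cast_add, Nat.cast_one]
    exact this
  have hℓ23 : ℓ ^ 2 ≤ ℓ ^ 3 := pow_le_pow_right₀ hℓ1 (by norm_num)
  intro t ht htT
  have htpos : (0 : ℝ) < t := by exact_mod_cast ht
  refine ⟨⟨ws, isProjection_minimizers hρ h0 h1 hlam hws _, (hrate t ht htT).trans ?_⟩, ?_⟩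
  · have : C₀ ≤ C₀ + Λ * (4 * C₀) / τ + 1 := by
      have : 0 ≤ Λ * (4 * C₀) / τ := by positivity
      linarith
    gcongr
  · rw [iInf_objective hws, objective_sub_minimum hρ h0 h1 hlam hws]
    refine (objQuad_le hρ h0 h1 _).trans ?_
    have havg := norm_weightedAvg_sub_sq_le ht₁0.le (fun k => w k s) ws ht
      (A := C₀ * t₁ * ℓ ^ 2) (by positivity) (hlog t htT) hℓ1
      fun k hk hkt => hrate k hk (hkt.trans htT)
    have hone : 1 ≤ t₁ / τ := (one_le_div hτ0).2 hτt
    calc Λ * ‖weightedAvg t₁ (fun k => w k s) t - ws‖ ^ 2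
        ≤ Λ * (4 * (C₀ * t₁ * ℓ ^ 2) * ℓ / t) := by gcongr
      _ = Λ * (4 * C₀) * t₁ * ℓ ^ 3 / t * 1 := by ring
      -- The estimate obtained so far is linear in `t₁`; the factor `t₁ / τ ≥ 1` brings it to the
      -- stated form.
      _ ≤ Λ * (4 * C₀) * t₁ * ℓ ^ 3 / t * (t₁ / τ) := by gcongr
      _ = Λ * (4 * C₀) / τ * t₁ ^ 2 * ℓ ^ 3 / t := by ring
      _ ≤ _ := by
          gcongr
          linarith

end FastRates

end AUC

end

/-! ### The theorem for all admissible constants -/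

theorem mainTheorem7 :
    ∃ m : ℕ,
    ∀ (d : ℕ) (X : Set (AUC.Vec d)) (ρ : Measure (AUC.Sample d)) (lam : ℝ),
      Bornology.IsBounded X →
      IsProbabilityMeasure ρ →
      (∀ᵐ z ∂ρ, z.1 ∈ X ∧ (z.2 = 1 ∨ z.2 = -1)) →
      0 < AUC.posProb ρ → AUC.posProb ρ < 1 →
      0 < lam →
      -- the assumptions of the general result hold for this regularizer
      AUC.SelfBounding (AUC.l2Reg (d := d) lam) (2 * lam) 0 ∧
      AUC.ConvexityModulus (AUC.l2Reg (d := d) lam) lam ∧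
      AUC.QuadraticGrowth (AUC.objective ρ (AUC.l2Reg lam)) (lam / 2) ∧
      -- the fast rates, for all admissible constants
      ∀ A₁ A₂ σφ σΩ : ℝ,
        0 ≤ A₁ → 0 ≤ A₂ → AUC.SelfBounding (AUC.l2Reg (d := d) lam) A₁ A₂ →
        0 < σφ → AUC.QuadraticGrowth (AUC.objective ρ (AUC.l2Reg lam)) σφ →
        0 ≤ σΩ → AUC.ConvexityModulus (AUC.l2Reg (d := d) lam) σΩ → σΩ ≤ σφ →
        ∃ C : ℝ, 0 < C ∧
          ∀ (δ : ℝ) (T : ℕ) (t₁ : ℝ),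
            0 < δ → δ < 1 → 2 < T →
            32 * AUC.constC₁ X A₁ / σφ * Real.log (2 * T / δ) ≤ t₁ →
            ∀ (S : Type*) (mS : MeasurableSpace S) (P : Measure S)
              (z : ℕ → S → AUC.Sample d) (w : ℕ → S → AUC.Vec d),
              IsProbabilityMeasure P →
              (∀ t, Measurable (z t)) →
              (∀ t, P.map (z t) = ρ) →
              iIndepFun z P →
              (∀ s, AUC.IsSPAUC (AUC.stepSize σφ σΩ t₁) (AUC.l2Reg lam)
                (fun t => z t s) (fun t => w t s)) →
              ENNReal.ofReal (1 - δ) ≤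
                P {s | ∀ t : ℕ, 1 ≤ t → t ≤ T →
                  (∃ ws, AUC.IsProjection
                      (AUC.minimizers (AUC.objective ρ (AUC.l2Reg lam))) (w t s) ws ∧
                    ‖w t s - ws‖ ^ 2 ≤ C * t₁ * Real.log (T / δ) ^ m / t) ∧
                  AUC.objective ρ (AUC.l2Reg lam) (AUC.weightedAvg t₁ (fun k => w k s) t)
                      - (⨅ v, AUC.objective ρ (AUC.l2Reg lam) v)
                    ≤ C * t₁ ^ 2 * Real.log (T / δ) ^ m / t} := by
  -- Two logarithms come from the iterates, where the bias contributes `L (1 + log t)`, and a third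
  -- from the average.
  refine ⟨3, fun d X ρ lam hX hρ hXρ h0 h1 hlam => ?_⟩
  have hκ : 1 ≤ AUC.kappa X := le_max_left _ _
  have hgood : ∀ᵐ z ∂ρ, z ∈ AUC.goodSet d (AUC.kappa X) :=
    hXρ.mono fun z hz => ⟨AUC.norm_le_kappa hX hz.1, hz.2⟩
  refine ⟨AUC.selfBounding_l2Reg hlam, AUC.convexityModulus_l2Reg hlam,
    AUC.quadraticGrowth_objective hgood h0 h1 hlam, ?_⟩
  intro A₁ A₂ σφ σΩ _ _ _ hσ hgrow _ _ hΩ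
  obtain ⟨C, hC, h⟩ := AUC.exists_fast_rate hgood hκ h0 h1 hlam hσ hgrow hΩ
  refine ⟨C, hC, fun δ T t₁ hδ hδ1 hT ht₁ => h δ T t₁ hδ hδ1 hT (le_trans ?_ ht₁)⟩
  have hlog : 0 ≤ Real.log (2 * T / δ) := by
    have hT' : (2 : ℝ) < T := by exact_mod_cast hT
    refine Real.log_nonneg ((one_le_div hδ).2 ?_)
    linarith
  -- The bound `C₁ ≥ 16 κ²` turns the condition on `t₁` into the one with `512 κ²`, which makes the
  -- steps small enough for the iterates to stay bounded.
  have hC₁ : 16 * AUC.kappa X ^ 2 ≤ AUC.constC₁ X A₁ := le_max_right _ _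
  have : 512 * AUC.kappa X ^ 2 ≤ 32 * AUC.constC₁ X A₁ := by linarith
  gcongr
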